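/- **Theorem 1 (Sample complexity of fidelity estimation).** *Protocol.* Let $1\le k\le n$ and let $\rho$ be an $n$-qubit state. One round consumes one copy of $\rho$: choose a uniformly random set $A\subseteq[n]$ of $k$ qubits, measure every qubit outside $A$ in the $Z$ basis (outcome $z\in\{0,1\}^{n-k}$), and measure every qubit of $A$ in an independent uniformly random Pauli basis $X$, $Y$ or $Z$ (outcomes $s_q$, $q\in A$, with post-measurement states $|s_q\rangle$). For a pure $n$-qubit target state $|\psi\rangle$ with amplitudes $\Psi(x)=\langle x|\psi\rangle$, $x\in\{0,1\}^n$, let $|\Psi_{A,z}\rangle$ be the normalization of $\sum_{y\in\{0,1\}^A}\Psi(y\Vert z)\,|y\rangle$, where $y\Vert z$ has the bits $y$ on $A$ and $z$ elsewhere (and $|\Psi_{A,z}\rangle=0$ if this vector vanishes). The local overlap of the round is $$\omega=\langle\Psi_{A,z}|\bigotimes_{q\in A}\bigl(3|s_q\rangle\langle s_q|-I\bigr)|\Psi_{A,z}\rangle .$$ From $T$ independent rounds and a number $K$ of batches, the estimate $\hat F$ is the median of the $K$ means of $\omega$ over consecutive disjoint batches of $\lfloor T/K\rfloor$ rounds.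 *Mixing time.* Let $\pi(x)=|\Psi(x)|^2$ and $N=\sum_{r=1}^k\binom nr$. The Markov chain induced by $|\psi\rangle$ has the support of $\pi$ as state space, with transition probabilities $P(x,y)=\frac1N\cdot\frac{\pi(y)}{\pi(x)+\pi(y)}$ if $x\ne y$ differ in at most $k$ bits, $P(x,y)=0$ if they differ in more, and $P(x,x)=1-\sum_{y\neq x}P(x,y)$. Its mixing time is $\tau=1/(1-\lambda_1)$, where $\lambda_1$ is the second largest eigenvalue of $P$, counted with multiplicity ($\lambda_1=0$ if the support is a single point). *Statement.* There is a universal constant $C>0$ such that the following holds for all $1\le k\le n$, all $M\ge1$, every $n$-qubit state $\rho$ and all pure $n$-qubit target states $|\psi_1\rangle,\dots,|\psi_M\rangle$ whose induced chains have $\lambda_1<1$, i.e. finite mixing times $\tau_1,\dots,\tau_M$. Put $F_i=\langle\psi_i|\rho|\psi_i\rangle$, let $\omega^{(i)}$ be the local overlap for the target $|\psi_i\rangle$, and let $b_i=\mathbb E[\omega^{(i)}]-F_i$ be its bias. 1. For every $i$, $\;0\le b_i\le\bigl(1-\tfrac1{\tau_i}\bigr)(1-F_i)$. 2. Let $\varepsilon,\delta>0$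 and let $c_b$ satisfy $\frac{c_b}{\tau_i}\in(0,1)$ for all $i$. Suppose that for every $i$ the bias bound or the bias itself is not too close to $\varepsilon$: $\;1-\frac1{\tau_i}\le\bigl(1-\frac{c_b}{\tau_i}\bigr)\varepsilon\;$ or $\;b_i\le\bigl(1-\frac{c_b}{\tau_i}\bigr)\varepsilon$. Then for every integer $$T\ \ge\ C\cdot 2^{2k}\,\frac{\max_i\tau_i^2}{(c_b\,\varepsilon)^2}\,\ln\Bigl(\frac{2M}{\delta}\Bigr)$$ the data of one and the same run of $T$ rounds, post-processed for each target with $K=\lceil 2\ln(2M/\delta)\rceil$ batches, give estimates $\hat F_1,\dots,\hat F_M$ that satisfy $|\hat F_i-F_i|\le\varepsilon$ for all $i$ simultaneously, with probability at least $1-\delta$. -/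

import Mathlib

open MeasureTheory Matrix
open scoped ComplexOrder

namespace FidelityEstimation

noncomputable section

/-! ### States -/

/-- Computational basis labels `x ∈ {0,1}ⁿ`. -/
abbrev BitString (n : ℕ) : Type := Fin n → Bool

/-- Density matrices of `n` qubits in the computational basis. -/
def IsState {n : ℕ} (ρ : Matrix (BitString n) (BitString n) ℂ) : Prop :=
  ρ.PosSemidef ∧ ρ.trace = 1

/-- Amplitude vectors `Ψ(x) = ⟨x|ψ⟩` of normalized pure states of `n` qubits. -/
def IsPureState {n : ℕ} (ψ : BitString n → ℂ) : Prop :=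
  ∑ x, ‖ψ x‖ ^ 2 = 1

/-- The expectation `⟨φ|ρ|φ⟩`. For a state `ρ` and a pure state `φ` it is the fidelity between them;
it is also the Born probability of the outcome `φ` of a measurement of `ρ`. -/
def fidelity {n : ℕ} (ρ : Matrix (BitString n) (BitString n) ℂ) (φ : BitString n → ℂ) : ℝ :=
  (star φ ⬝ᵥ (ρ *ᵥ φ)).re

/-! ### Measurement phase -/

/-- The three single-qubit measurement bases. -/
inductive Pauli : Type
  | X
  | Y
  | Z
  deriving DecidableEq

instance : Fintype Pauli where
  elems := {Pauli.X, Pauli.Y, Pauli.Z}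
  complete p := by cases p <;> simp

/-- The eigenstate of a Pauli operator which is the outcome `s` of the measurement in its basis
(`false` for the eigenvalue `1`, `true` for the eigenvalue `-1`). -/
def Pauli.eigenstate : Pauli → Bool → Bool → ℂ
  | .X, s, x => (if s && x then -1 else 1) / (Real.sqrt 2 : ℂ)
  | .Y, s, x => (if x then (if s then -Complex.I else Complex.I) else 1) / (Real.sqrt 2 : ℂ)
  | .Z, s, x => if x = s then 1 else 0

/-- The record of one round of measurements: the subset `A`, the basis in which each qubit was
measured, and the outcome on each qubit. The restriction of `outcome` to the complement of `A` is
the string `z`, its restriction to `A` is the string `s`. -/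
@[ext] structure Round (n : ℕ) : Type where
  A : Finset (Fin n)
  basis : Fin n → Pauli
  outcome : BitString n

instance (n : ℕ) : Fintype (Round n) :=
  Fintype.ofEquiv (Finset (Fin n) × (Fin n → Pauli) × BitString n)
    { toFun := fun p => ⟨p.1, p.2.1, p.2.2⟩
      invFun := fun r => (r.A, r.basis, r.outcome)
      left_inv := fun _ => rfl
      right_inv := fun _ => rfl }

instance (n : ℕ) : MeasurableSpace (Round n) := ⊤

instance (n : ℕ) : DiscreteMeasurableSpace (Round n) := ⟨fun _ => trivial⟩

/-- The product state on which a round projects the `n` qubits. -/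
def Round.productState {n : ℕ} (r : Round n) : BitString n → ℂ :=
  fun x => ∏ q, (r.basis q).eigenstate (r.outcome q) (x q)

/-- The probability of the record `r` when one copy of `ρ` is measured: `A` is a uniformly random
`k`-subset of the qubits, each qubit of `A` is measured in an independent uniformly random Pauli
basis, every other qubit is measured in the `Z` basis, and the outcomes follow the Born rule. -/
def roundProb {n : ℕ} (k : ℕ) (ρ : Matrix (BitString n) (BitString n) ℂ) (r : Round n) : ℝ :=
  (if r.A.card = k then 1 / (n.choose k : ℝ) else 0) *
    (∏ q, if q ∈ r.A then (1 / 3 : ℝ) else if r.basis q = Pauli.Z then 1 else 0) *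
    fidelity ρ r.productState

/-- The law of the record of one round. -/
def roundLaw {n : ℕ} (k : ℕ) (ρ : Matrix (BitString n) (BitString n) ℂ) : Measure (Round n) :=
  ∑ r, ENNReal.ofReal (roundProb k ρ r) • Measure.dirac r

/-- The law of the records of `T` rounds, on `T` independent copies of `ρ`. -/
def dataLaw {n : ℕ} (k : ℕ) (ρ : Matrix (BitString n) (BitString n) ℂ) (T : ℕ) :
    Measure (Fin T → Round n) :=
  Measure.pi fun _ => roundLaw k ρ

/-! ### Query phase and local overlaps -/

/-- The string `x_z`: the bits of `x` on `A`, those of `z` elsewhere. -/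
def insertBits {n : ℕ} (A : Finset (Fin n)) (x : A → Bool) (z : BitString n) : BitString n :=
  fun q => if h : q ∈ A then x ⟨q, h⟩ else z q

/-- The unnormalized reduced state `Ψ'_{A,z}` on the qubits of `A`. -/
def reducedAmp {n : ℕ} (ψ : BitString n → ℂ) (r : Round n) : (r.A → Bool) → ℂ :=
  fun x => ψ (insertBits r.A x r.outcome)

/-- The normalized reduced state `Ψ_{A,z}`. It is `0` if `Ψ'_{A,z} = 0`. -/
def reducedState {n : ℕ} (ψ : BitString n → ℂ) (r : Round n) : (r.A → Bool) → ℂ :=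
  fun x => reducedAmp ψ r x / (Real.sqrt (∑ y, ‖reducedAmp ψ r y‖ ^ 2) : ℂ)

/-- The classical shadow `⨂_{q ∈ A} (3 |s_q⟩⟨s_q| - I)` of the qubits of `A`. -/
def localShadow {n : ℕ} (r : Round n) : Matrix (r.A → Bool) (r.A → Bool) ℂ :=
  Matrix.of fun x y => ∏ q : r.A,
    (3 * (r.basis q).eigenstate (r.outcome q) (x q) *
      star ((r.basis q).eigenstate (r.outcome q) (y q)) - if x q = y q then 1 else 0)

/-- The local overlap `ω` of one round. -/
def localOverlap {n : ℕ} (ψ : BitString n → ℂ) (r : Round n) : ℝ :=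
  (star (reducedState ψ r) ⬝ᵥ (localShadow r *ᵥ reducedState ψ r)).re

/-- The bias `𝔼[ω] - ⟨ψ|ρ|ψ⟩` of the local overlap as an estimator of the fidelity. -/
def bias {n : ℕ} (k : ℕ) (ρ : Matrix (BitString n) (BitString n) ℂ) (ψ : BitString n → ℂ) : ℝ :=
  (∫ r, localOverlap ψ r ∂roundLaw k ρ) - fidelity ρ ψ

/-! ### Median of means -/

/-- The median of `K` real numbers (the mean of the two middle ones if `K` is even). -/
def median {K : ℕ} (v : Fin K → ℝ) : ℝ :=
  let l := ((Finset.univ : Finset (Fin K)).val.map v).sort (· ≤ ·)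
  (l.getD ((K - 1) / 2) 0 + l.getD (K / 2) 0) / 2

/-- The mean of batch `j` (counted from `0`), when the local overlaps of `T` rounds are split into
`K` consecutive batches of size `⌊T / K⌋`. -/
def batchMean {n T : ℕ} (ψ : BitString n → ℂ) (K : ℕ) (data : Fin T → Round n) (j : Fin K) : ℝ :=
  (1 / ((T / K : ℕ) : ℝ)) *
    ∑ t ∈ (Finset.univ : Finset (Fin T)).filter
        (fun t : Fin T => (j : ℕ) * (T / K) ≤ (t : ℕ) ∧ (t : ℕ) < ((j : ℕ) + 1) * (T / K)),
      localOverlap ψ (data t)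

/-- The output of the protocol for the target `ψ`: the median of the `K` batch means. -/
def fidelityEstimate {n T : ℕ} (ψ : BitString n → ℂ) (K : ℕ) (data : Fin T → Round n) : ℝ :=
  median (batchMean ψ K data)

/-! ### The Markov chain induced by a target state -/

/-- `π(x) = |⟨x|ψ⟩|²`. -/
def targetProb {n : ℕ} (ψ : BitString n → ℂ) (x : BitString n) : ℝ :=
  ‖ψ x‖ ^ 2

/-- The state space of the chain: the support of `π`. -/
abbrev Support {n : ℕ} (ψ : BitString n → ℂ) : Type :=
  {x : BitString n // targetProb ψ x ≠ 0}

/-- The number of strings at Hamming distance between `1` and `k` from a given one. -/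
def neighborCount (n k : ℕ) : ℕ :=
  ∑ r ∈ Finset.Icc 1 k, n.choose r

/-- Probability of the step from `x` to `y ≠ x`. -/
def stepProb {n : ℕ} (k : ℕ) (ψ : BitString n → ℂ) (x y : BitString n) : ℝ :=
  if hammingDist x y ≤ k then
    1 / (neighborCount n k : ℝ) * (targetProb ψ y / (targetProb ψ x + targetProb ψ y))
  else 0

/-- The transition matrix of the chain on the support of `π`. -/
def transitionMatrix {n : ℕ} (k : ℕ) (ψ : BitString n → ℂ) :
    Matrix (Support ψ) (Support ψ) ℝ :=
  Matrix.of fun x y =>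
    if x = y then 1 - ∑ z : Support ψ with z ≠ x, stepProb k ψ x z else stepProb k ψ x y

/-- The second largest eigenvalue `λ₁` of the transition matrix, counted with multiplicity: the
entry at position `1` of the decreasing list `λ₀ ≥ λ₁ ≥ …` of the roots of the characteristic
polynomial. It is `0` if the support of `π` is a single point. -/
def secondEigenvalue {n : ℕ} (k : ℕ) (ψ : BitString n → ℂ) : ℝ :=
  ((transitionMatrix k ψ).charpoly.roots.sort (· ≥ ·)).getD 1 0

/-- The mixing time `τ = 1 / (1 - λ₁)`, the inverse spectral gap; it is meant for chains with `λ₁ < 1`. -/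
def mixingTime {n : ℕ} (k : ℕ) (ψ : BitString n → ℂ) : ℝ :=
  1 / (1 - secondEigenvalue k ψ)

end

end FidelityEstimation

open FidelityEstimation

/-! For a set A of qubits let Π_A be `classProj ψ (agreeOff A)`, the projector onto the span of the
pieces of ψ with fixed bits off A. Inverting the shadow channel qubit by qubit shows that 𝔼[ω] is
the average of tr(ρ Π_A) over the k-sets A (`sum_shadow_localOverlap`, `integral_localOverlap`).

Such projectors decrease when the partition gets coarser (`classProj_sub_posSemidef`). The one-class
partition gives |ψ⟩⟨ψ|, so the bias is nonnegative. The partition into pairs {x, x ⊕ d} with d ⊆ A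
nonempty is finer than that of A; double counting (`average_le_average`) then bounds 𝔼[ω] by tr(ρ
S), where S = `flipAverage k ψ` averages the pair projectors over all flips of 1 to k bits. On the
support of ψ, conjugation by diag(ψ) turns S into the transition matrix
(`mul_transitionMatrix_apply`). So S is positive semidefinite, fixes ψ and has second eigenvalue λ₁,
whence S ≤ |ψ⟩⟨ψ| + λ₁(1 - |ψ⟩⟨ψ|) and the bias is at most λ₁(1 - F), with λ₁ = 1 - 1/τ.

For the sample size, |ω| ≤ 2^k (`abs_localOverlap_le`) makes Chebyshev's inequality work on each
batch, and the median boosts this to failure probability 2^(-K) (`medianOfMeans_far`). The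
statistical error is kept below c_b ε/τ, which is what the assumption on the bias leaves of ε. A
union bound over the targets concludes. -/

namespace FidelityEstimation

/-! ### Quadratic forms and the second eigenvalue -/

section LinearAlgebra

variable {ι : Type*} [Fintype ι]

lemma star_dotProduct_self_eq_sum (φ : ι → ℂ) :
    star φ ⬝ᵥ φ = ((∑ i, ‖φ i‖ ^ 2 : ℝ) : ℂ) := by
  simp only [dotProduct, Pi.star_apply, RCLike.star_def, Complex.conj_mul']
  push_cast; rfl

/-- The trace of a positive semidefinite matrix against a matrix with nonnegative quadratic form
is nonnegative. -/
lemma re_trace_mul_nonneg {ρ G : Matrix ι ι ℂ} (hρ : ρ.PosSemidef)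
    (hG : ∀ φ : ι → ℂ, 0 ≤ (star φ ⬝ᵥ (G *ᵥ φ)).re) : 0 ≤ (ρ * G).trace.re := by
  classical
  obtain ⟨m, v, rfl⟩ := Matrix.posSemidef_iff_eq_sum_vecMulVec.mp hρ
  rw [Finset.sum_mul, Matrix.trace_sum, Complex.re_sum]
  refine Finset.sum_nonneg fun i _ => ?_
  rw [Matrix.vecMulVec_mul, Matrix.trace_vecMulVec, dotProduct_comm, ← dotProduct_mulVec]
  exact hG _

lemma star_dotProduct_mulVec_eq (U : Matrix ι ι ℂ) (x y : ι → ℂ) :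
    star x ⬝ᵥ (U *ᵥ y) = star (Uᴴ *ᵥ x) ⬝ᵥ y := by
  rw [star_mulVec, conjTranspose_conjTranspose, ← dotProduct_mulVec]

/-- Take for `i₀` an index of the head of the sorted list; every other value, with multiplicity,
lies in the tail. With a single value the claim is vacuous, so the default 0 does no harm. -/
lemma exists_forall_ne_le_sort_getD_one [Nonempty ι] (μ : ι → ℝ) :
    ∃ i₀, ∀ i, i ≠ i₀ → μ i ≤ ((Finset.univ.val.map μ).sort (· ≥ ·)).getD 1 0 := by
  classical
  set l := (Finset.univ.val.map μ).sort (· ≥ ·) with hl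
  have hcoe : (l : Multiset ℝ) = Finset.univ.val.map μ := Multiset.sort_eq _ _
  have hs : l.Pairwise (· ≥ ·) := Multiset.pairwise_sort _ _
  match l, hcoe, hs with
  | [], hcoe, _ =>
    have := congrArg Multiset.card hcoe
    simp at this
    exact absurd this.symm Fintype.card_ne_zero
  | a :: t, hcoe, hs =>
    have ha : a ∈ Finset.univ.val.map μ := by rw [← hcoe]; simp
    obtain ⟨i₀, -, rfl⟩ := Multiset.mem_map.1 ha
    refine ⟨i₀, fun i hi => ?_⟩
    rw [← Finset.insert_erase (Finset.mem_univ i₀), Finset.insert_val_of_notMem (by simp),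
      Multiset.map_cons, ← Multiset.cons_coe, Multiset.cons_inj_right] at hcoe
    have hit : μ i ∈ t := by
      rw [← Multiset.mem_coe, hcoe]
      exact Multiset.mem_map_of_mem _ (Finset.mem_erase.2 ⟨hi, Finset.mem_univ i⟩)
    match t, hs, hit with
    | b :: t', hs, hit =>
      simp only [List.getD_cons_succ, List.getD_cons_zero]
      rcases List.mem_cons.1 hit with h | h
      · exact h.le
      · exact (List.pairwise_cons.1 (List.pairwise_cons.1 hs).2).1 _ h

/-- If a real matrix `P` is similar to a positive semidefinite Hermitian matrix `S` with a unit
eigenvector `v` for the eigenvalue `1` and if the second eigenvalue is less than `1`, then it is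
nonnegative and controls the quadratic form of `S` on the complement of `v`. -/
lemma spectral_bound [DecidableEq ι] [Nonempty ι] {S : Matrix ι ι ℂ} {P : Matrix ι ι ℝ} (hS : S.PosSemidef)
    (hP : (P.map Complex.ofRealHom).charpoly = S.charpoly) {v : ι → ℂ} (hv : ∑ i, ‖v i‖ ^ 2 = 1)
    (hSv : S *ᵥ v = v) (hl : (P.charpoly.roots.sort (· ≥ ·)).getD 1 0 < 1) :
    0 ≤ (P.charpoly.roots.sort (· ≥ ·)).getD 1 0 ∧
    ∀ φ : ι → ℂ, (star φ ⬝ᵥ (S *ᵥ φ)).re ≤ ‖star v ⬝ᵥ φ‖ ^ 2 +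
      (P.charpoly.roots.sort (· ≥ ·)).getD 1 0 * (∑ i, ‖φ i‖ ^ 2 - ‖star v ⬝ᵥ φ‖ ^ 2) := by
  set hH := hS.isHermitian
  set μ := hH.eigenvalues with hμ
  have hroots : P.charpoly.roots = Finset.univ.val.map μ := by
    have h1 : P.charpoly = ∏ i, (Polynomial.X - Polynomial.C (μ i)) := by
      apply Polynomial.map_injective Complex.ofRealHom Complex.ofReal_injective
      rw [← Matrix.charpoly_map, hP, hH.charpoly_eq, Polynomial.map_prod]
      simp [μ]
    rw [h1, Polynomial.roots_prod _ _ (by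
      simp [Finset.prod_ne_zero_iff, Polynomial.X_sub_C_ne_zero])]
    simp
  rw [hroots] at hl ⊢
  obtain ⟨i₀, hi₀⟩ := exists_forall_ne_le_sort_getD_one μ
  set lam := ((Finset.univ.val.map μ).sort (· ≥ ·)).getD 1 0 with hlam
  -- Either there is no second eigenvalue and the default 0 is taken, or it is an eigenvalue of a
  -- positive semidefinite matrix.
  have hlam0 : 0 ≤ lam := by
    rw [hlam, List.getD_eq_getElem?_getD]
    rcases h : ((Finset.univ.val.map μ).sort (· ≥ ·))[1]? with _ | b
    · simp
    · have hb := List.mem_of_getElem? h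
      rw [Multiset.mem_sort, Multiset.mem_map] at hb
      obtain ⟨i, -, rfl⟩ := hb
      exact hS.eigenvalues_nonneg i
  refine ⟨hlam0, fun φ => ?_⟩
  set U : Matrix ι ι ℂ := hH.eigenvectorUnitary.1 with hU
  have hUU : U * Uᴴ = 1 := Unitary.coe_mul_star_self hH.eigenvectorUnitary
  have hUU' : Uᴴ * U = 1 := Unitary.coe_star_mul_self hH.eigenvectorUnitary
  have hSU : S = U * diagonal (fun i => (μ i : ℂ)) * Uᴴ := by
    conv_lhs => rw [hH.spectral_theorem, Unitary.conjStarAlgAut_apply]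
    rfl
  have hquad : ∀ x : ι → ℂ, (star x ⬝ᵥ (S *ᵥ x)).re = ∑ i, μ i * ‖(Uᴴ *ᵥ x) i‖ ^ 2 := by
    intro x
    rw [hSU, ← mulVec_mulVec, ← mulVec_mulVec, star_dotProduct_mulVec_eq, dotProduct,
      Complex.re_sum]
    refine Finset.sum_congr rfl fun i _ => ?_
    rw [mulVec_diagonal, Pi.star_apply, RCLike.star_def, mul_left_comm, Complex.conj_mul',
      Complex.re_ofReal_mul]
    norm_cast
  have hinner : ∀ x y : ι → ℂ, star x ⬝ᵥ y = star (Uᴴ *ᵥ x) ⬝ᵥ (Uᴴ *ᵥ y) := by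
    intro x y
    rw [← star_dotProduct_mulVec_eq, mulVec_mulVec, hUU, one_mulVec]
  have hnorm : ∀ x : ι → ℂ, ∑ i, ‖x i‖ ^ 2 = ∑ i, ‖(Uᴴ *ᵥ x) i‖ ^ 2 := by
    intro x
    have := hinner x x
    rw [star_dotProduct_self_eq_sum, star_dotProduct_self_eq_sum] at this
    exact_mod_cast this
  set w := Uᴴ *ᵥ v with hw
  set c := Uᴴ *ᵥ φ with hc
  have hDw : ∀ i, (μ i : ℂ) * w i = w i := by
    intro i
    have : diagonal (fun i => (μ i : ℂ)) *ᵥ w = w := by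
      have h := congrArg (Uᴴ *ᵥ ·) hSv
      rw [hw, mulVec_mulVec]
      simpa only [hSU, mulVec_mulVec, ← mul_assoc, hUU', one_mul] using h
    simpa only [mulVec_diagonal] using congrFun this i
  -- A nonzero component of the fixed vector at `i` forces `μ i = 1`, but away from `i₀` the
  -- eigenvalues are at most λ₁ < 1. Hence `v` is the eigenvector of index `i₀` up to a phase.
  have hw0 : ∀ i, i ≠ i₀ → w i = 0 := by
    intro i hi
    by_contra h
    have h1 : (μ i : ℂ) = 1 := by
      have := hDw i
      exact mul_right_cancel₀ h (this.trans (one_mul _).symm)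
    have h2 : μ i = 1 := by exact_mod_cast h1
    have := hi₀ i hi
    linarith
  have hw1 : ‖w i₀‖ ^ 2 = 1 := by
    rw [hnorm v, Finset.sum_eq_single i₀ (fun i _ hi => by simp [← hw, hw0 i hi]) (by simp)] at hv
    exact hv
  have hμ1 : μ i₀ = 1 := by
    have h0 : w i₀ ≠ 0 := by
      intro h
      simp [h] at hw1
    exact_mod_cast mul_right_cancel₀ h0 ((hDw i₀).trans (one_mul _).symm)
  have hover : ‖star v ⬝ᵥ φ‖ ^ 2 = ‖c i₀‖ ^ 2 := by
    rw [hinner, ← hw, ← hc, dotProduct,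
      Finset.sum_eq_single i₀ (fun i _ hi => by simp [hw0 i hi]) (by simp), norm_mul, mul_pow]
    simp [hw1]
  rw [hquad, hover, hnorm φ, ← hc, ← Finset.add_sum_erase _ _ (Finset.mem_univ i₀),
    ← Finset.add_sum_erase _ (fun i => ‖c i‖ ^ 2) (Finset.mem_univ i₀), hμ1, one_mul,
    add_sub_cancel_left, Finset.mul_sum]
  gcongr with i hi
  exact hi₀ i (Finset.ne_of_mem_erase hi)

end LinearAlgebra

/-! ### Projectors attached to a partition of the basis labels -/

section ClassProjection

variable {ι : Type*} [Fintype ι]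

open Classical in
/-- The total weight of the class of `x`. -/
noncomputable def classWeight (ψ : ι → ℂ) (s : Setoid ι) (x : ι) : ℝ :=
  ∑ w with s x w, ‖ψ w‖ ^ 2

open Classical in
/-- The projector onto the span of the restrictions of `ψ` to the classes of `s`. -/
noncomputable def classProj (ψ : ι → ℂ) (s : Setoid ι) : Matrix ι ι ℂ :=
  Matrix.of fun x y => if s x y then ψ x * star (ψ y) / (classWeight ψ s x : ℂ) else 0

lemma classWeight_congr (ψ : ι → ℂ) {s : Setoid ι} {x y : ι} (h : s x y) :
    classWeight ψ s x = classWeight ψ s y := by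
  classical
  unfold classWeight
  congr 1
  ext w
  simp only [Finset.mem_filter, Finset.mem_univ, true_and]
  exact ⟨fun h' => s.trans (s.symm h) h', fun h' => s.trans h h'⟩

lemma eq_zero_of_classWeight_eq_zero {ψ : ι → ℂ} {s : Setoid ι} {x : ι}
    (h : classWeight ψ s x = 0) : ψ x = 0 := by
  classical
  have := (Finset.sum_eq_zero_iff_of_nonneg (fun _ _ => by positivity)).1 h x
    (by simp)
  simpa using this

lemma classProj_isHermitian (ψ : ι → ℂ) (s : Setoid ι) : (classProj ψ s).IsHermitian := by
  classical
  ext x y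
  simp only [classProj, conjTranspose_apply, of_apply]
  by_cases h : s x y
  · rw [if_pos h, if_pos (s.symm h), classWeight_congr ψ h]
    simp [mul_comm]
  · rw [if_neg h, if_neg fun h' => h (s.symm h'), star_zero]

/-- The restriction of ψ to a class of the coarser relation is a sum of its restrictions to finer
classes, so it is fixed by the finer projector. -/
lemma classProj_mul_of_le (ψ : ι → ℂ) {s t : Setoid ι} (hst : s ≤ t) :
    classProj ψ s * classProj ψ t = classProj ψ t := by
  classical
  ext x z
  simp only [classProj, mul_apply, of_apply]
  have hterm : ∀ y, (if s x y then ψ x * star (ψ y) / (classWeight ψ s x : ℂ) else 0) *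
      (if t y z then ψ y * star (ψ z) / (classWeight ψ t y : ℂ) else 0) =
      (if t x z then ψ x * star (ψ z) / (classWeight ψ t x : ℂ) else 0) *
      ((if s x y then (‖ψ y‖ ^ 2 : ℂ) else 0) / (classWeight ψ s x : ℂ)) := by
    intro y
    by_cases h : s x y
    · have ht : t x y := hst h
      have hiff : t y z ↔ t x z := ⟨fun h' => t.trans ht h', fun h' => t.trans (t.symm ht) h'⟩
      rw [if_pos h, if_pos h, if_congr hiff rfl rfl, classWeight_congr ψ (t.symm ht)]
      split_ifs
      · rw [← Complex.conj_mul', RCLike.star_def]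
        ring
      · simp
    · simp [h]
  simp only [hterm]
  rw [← Finset.mul_sum, ← Finset.sum_div, ← Finset.sum_filter]
  have hsum : (∑ y with s x y, (‖ψ y‖ ^ 2 : ℂ)) = (classWeight ψ s x : ℂ) := by
    simp [classWeight]
  rw [hsum]
  -- On a class of weight 0 the vector vanishes, so the division by 0 is harmless.
  by_cases h : classWeight ψ s x = 0
  · simp [eq_zero_of_classWeight_eq_zero h]
  · rw [div_self (by exact_mod_cast h), mul_one]

/-- The difference of nested orthogonal projectors is Hermitian and idempotent, hence of the form
`Bᴴ * B`. -/
lemma classProj_sub_posSemidef (ψ : ι → ℂ) {s t : Setoid ι} (hst : s ≤ t) :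
    (classProj ψ s - classProj ψ t).PosSemidef := by
  have h1 := classProj_mul_of_le ψ hst
  have h2 : classProj ψ t * classProj ψ s = classProj ψ t := by
    have := congrArg conjTranspose h1
    rwa [conjTranspose_mul, (classProj_isHermitian ψ s).eq, (classProj_isHermitian ψ t).eq] at this
  have h3 := classProj_mul_of_le ψ (le_refl s)
  have h4 := classProj_mul_of_le ψ (le_refl t)
  have hH := (classProj_isHermitian ψ s).sub (classProj_isHermitian ψ t)
  have : classProj ψ s - classProj ψ t =
      (classProj ψ s - classProj ψ t)ᴴ * (classProj ψ s - classProj ψ t) := by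
    rw [hH.eq, sub_mul, mul_sub, mul_sub, h1, h2, h3, h4]
    simp
  rw [this]
  exact posSemidef_conjTranspose_mul_self _

lemma classProj_posSemidef (ψ : ι → ℂ) (s : Setoid ι) : (classProj ψ s).PosSemidef := by
  have : classProj ψ s = (classProj ψ s)ᴴ * classProj ψ s := by
    rw [(classProj_isHermitian ψ s).eq, classProj_mul_of_le ψ le_rfl]
  rw [this]
  exact posSemidef_conjTranspose_mul_self _

lemma classProj_mulVec_self (ψ : ι → ℂ) (s : Setoid ι) : classProj ψ s *ᵥ ψ = ψ := by
  classical
  ext x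
  simp only [classProj, mulVec, dotProduct, of_apply, ite_mul, zero_mul]
  rw [← Finset.sum_filter]
  have hterm : ∀ y, ψ x * star (ψ y) / (classWeight ψ s x : ℂ) * ψ y =
      ψ x * ((‖ψ y‖ ^ 2 : ℂ) / (classWeight ψ s x : ℂ)) := by
    intro y
    rw [← Complex.conj_mul', RCLike.star_def]
    ring
  simp only [hterm]
  rw [← Finset.mul_sum, ← Finset.sum_div]
  have hsum : (∑ y with s x y, (‖ψ y‖ ^ 2 : ℂ)) = (classWeight ψ s x : ℂ) := by
    simp [classWeight]
  rw [hsum]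
  by_cases h : classWeight ψ s x = 0
  · simp [eq_zero_of_classWeight_eq_zero h]
  · rw [div_self (by exact_mod_cast h), mul_one]

lemma re_trace_mul_classProj_le {ρ : Matrix ι ι ℂ} (hρ : ρ.PosSemidef) (ψ : ι → ℂ)
    {s t : Setoid ι} (hst : s ≤ t) :
    (ρ * classProj ψ t).trace.re ≤ (ρ * classProj ψ s).trace.re := by
  classical
  have h := re_trace_mul_nonneg hρ (G := classProj ψ s - classProj ψ t) fun φ =>
    (Complex.le_def.1 ((classProj_sub_posSemidef ψ hst).dotProduct_mulVec_nonneg φ)).1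
  rw [mul_sub, trace_sub, Complex.sub_re] at h
  linarith

end ClassProjection

end FidelityEstimation

/-! ### Bit flips and double counting -/

namespace FidelityEstimation

/-- Two strings are related if they agree outside `A`. -/
def agreeOff {n : ℕ} (A : Finset (Fin n)) : Setoid (BitString n) where
  r x y := ∀ q, q ∉ A → x q = y q
  iseqv := ⟨fun _ _ _ => rfl, fun h q hq => (h q hq).symm, fun h h' q hq => (h q hq).trans (h' q hq)⟩

/-- The string `x` with the bits in `d` flipped. -/
def flipBits {n : ℕ} (d : Finset (Fin n)) (x : BitString n) : BitString n :=
  fun q => xor (x q) (decide (q ∈ d))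

/-- The positions at which two strings differ. -/
def diffSet {n : ℕ} (x y : BitString n) : Finset (Fin n) :=
  Finset.univ.filter fun q => x q ≠ y q

variable {n : ℕ}

lemma flipBits_flipBits (d : Finset (Fin n)) (x : BitString n) : flipBits d (flipBits d x) = x := by
  ext q; simp [flipBits]

lemma flipBits_diffSet (x y : BitString n) : flipBits (diffSet x y) x = y := by
  funext q
  simp only [flipBits, diffSet, Finset.mem_filter, Finset.mem_univ, true_and]
  cases x q <;> cases y q <;> rfl

lemma diffSet_flipBits (d : Finset (Fin n)) (x : BitString n) : diffSet x (flipBits d x) = d := by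
  ext q
  simp only [diffSet, Finset.mem_filter, Finset.mem_univ, true_and]
  by_cases h : q ∈ d <;> simp [flipBits, h]

lemma card_diffSet (x y : BitString n) : (diffSet x y).card = hammingDist x y := rfl

/-- Two strings are related if they are equal or differ by the flip of the bits in `d`. -/
def flipPair (d : Finset (Fin n)) : Setoid (BitString n) where
  r x y := y = x ∨ y = flipBits d x
  iseqv := ⟨fun _ => Or.inl rfl, by
      rintro x y (rfl | rfl)
      · exact Or.inl rfl
      · exact Or.inr (flipBits_flipBits d x).symm, by
      rintro x y z (rfl | rfl) (rfl | rfl)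
      · exact Or.inl rfl
      · exact Or.inr rfl
      · exact Or.inr rfl
      · exact Or.inl (flipBits_flipBits d x)⟩

lemma flipPair_le_agreeOff {d A : Finset (Fin n)} (h : d ⊆ A) : flipPair d ≤ agreeOff A := by
  rintro x y (rfl | rfl) q hq
  · rfl
  · have : q ∉ d := fun h' => hq (h h')
    simp [flipBits, this]

lemma classWeight_flipPair (ψ : BitString n → ℂ) {d : Finset (Fin n)} (hd : 1 ≤ d.card)
    (x : BitString n) :
    classWeight ψ (flipPair d) x = targetProb ψ x + targetProb ψ (flipBits d x) := by
  classical
  have hne : x ≠ flipBits d x := by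
    intro h
    have := diffSet_flipBits d x
    rw [← h] at this
    simp [diffSet] at this
    simp [← this] at hd
  have : (Finset.univ.filter fun w => (flipPair d) x w) = {x, flipBits d x} := by
    ext w
    simp only [Finset.mem_filter, Finset.mem_univ, true_and, Finset.mem_insert,
      Finset.mem_singleton]
    exact Iff.rfl
  unfold classWeight
  rw [this, Finset.sum_pair hne]
  rfl

/-- The sets of at least one and at most `k` positions. -/
def smallSets (n k : ℕ) : Finset (Finset (Fin n)) :=
  Finset.univ.filter fun d => 1 ≤ d.card ∧ d.card ≤ k

lemma sum_smallSets (k : ℕ) (f : Finset (Fin n) → ℝ) :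
    ∑ d ∈ smallSets n k, f d =
      ∑ r ∈ Finset.Icc 1 k, ∑ d ∈ Finset.powersetCard r Finset.univ, f d := by
  rw [← Finset.sum_fiberwise_of_maps_to (s := smallSets n k) (t := Finset.Icc 1 k)
    (g := Finset.card) (by simp [smallSets])]
  refine Finset.sum_congr rfl fun r hr => Finset.sum_congr ?_ fun _ _ => rfl
  rw [Finset.mem_Icc] at hr
  ext d
  simp only [smallSets, Finset.mem_filter, Finset.mem_univ, true_and, Finset.mem_powersetCard,
    Finset.subset_univ]
  constructor
  · exact fun h => h.2
  · rintro rfl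
    exact ⟨hr, rfl⟩

lemma card_smallSets (k : ℕ) : ((smallSets n k).card : ℝ) = neighborCount n k := by
  have := sum_smallSets (n := n) k fun _ => 1
  simpa [neighborCount] using this

lemma neighborCount_pos {k : ℕ} (hk : 1 ≤ k) (hkn : k ≤ n) : 0 < neighborCount n k :=
  Finset.sum_pos' (fun _ _ => Nat.zero_le _)
    ⟨1, by simp [hk], Nat.choose_pos (hk.trans hkn)⟩

/-- A function on `k`-sets which is below a function on all their small subsets is on average
below it. -/
lemma average_le_average {k : ℕ} (hk : 1 ≤ k) (hkn : k ≤ n) (g f : Finset (Fin n) → ℝ)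
    (h : ∀ d A, d ⊆ A → g A ≤ f d) :
    1 / (n.choose k : ℝ) * ∑ A ∈ Finset.powersetCard k Finset.univ, g A ≤
      1 / (neighborCount n k : ℝ) * ∑ d ∈ smallSets n k, f d := by
  have hN : (0 : ℝ) < neighborCount n k := by exact_mod_cast neighborCount_pos hk hkn
  have hC : (0 : ℝ) < n.choose k := by exact_mod_cast Nat.choose_pos hkn
  -- For each size `r` the average of `g` over `k`-sets is at most that of `f` over `r`-sets, by
  -- counting the pairs `d ⊆ A` in two ways. The weight `n.choose r` is chosen so that the sum over
  -- `r` yields the neighbour count.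
  have key : ∀ r ∈ Finset.Icc 1 k,
      (n.choose r : ℝ) * ∑ A ∈ Finset.powersetCard k Finset.univ, g A ≤
        n.choose k * ∑ d ∈ Finset.powersetCard r Finset.univ, f d := by
    intro r hr
    rw [Finset.mem_Icc] at hr
    have h1 : ∑ A ∈ Finset.powersetCard k (Finset.univ : Finset (Fin n)),
        ∑ d ∈ Finset.powersetCard r A, g A ≤
        ∑ A ∈ Finset.powersetCard k (Finset.univ : Finset (Fin n)),
        ∑ d ∈ Finset.powersetCard r A, f d :=
      Finset.sum_le_sum fun A _ => Finset.sum_le_sum fun d hd =>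
        h d A (Finset.mem_powersetCard.1 hd).1
    have h2 : ∑ A ∈ Finset.powersetCard k (Finset.univ : Finset (Fin n)),
        ∑ d ∈ Finset.powersetCard r A, g A =
        k.choose r * ∑ A ∈ Finset.powersetCard k Finset.univ, g A := by
      rw [Finset.mul_sum]
      refine Finset.sum_congr rfl fun A hA => ?_
      rw [Finset.sum_const, Finset.card_powersetCard, (Finset.mem_powersetCard.1 hA).2,
        nsmul_eq_mul]
    have h3 : ∑ A ∈ Finset.powersetCard k (Finset.univ : Finset (Fin n)),
        ∑ d ∈ Finset.powersetCard r A, f d =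
        (n - r).choose (k - r) * ∑ d ∈ Finset.powersetCard r Finset.univ, f d := by
      rw [Finset.sum_comm' (t' := Finset.powersetCard r Finset.univ)
        (s' := fun d => (Finset.powersetCard k Finset.univ).filter (d ⊆ ·)), Finset.mul_sum]
      · refine Finset.sum_congr rfl fun d hd => ?_
        have hd' := (Finset.mem_powersetCard.1 hd).2
        rw [Finset.sum_const, Finset.card_filter_powersetCard_subset _ _ _ (Finset.subset_univ _)
          (by lia), hd', Finset.card_univ, Fintype.card_fin, nsmul_eq_mul]
      · intro A d
        simp only [Finset.mem_powersetCard, Finset.mem_filter, Finset.subset_univ, true_and]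
        tauto
    rw [h2, h3] at h1
    have h4 : (n.choose k : ℝ) * k.choose r = n.choose r * (n - r).choose (k - r) := by
      exact_mod_cast Nat.choose_mul hr.2
    have h5 : (0 : ℝ) < k.choose r := by exact_mod_cast Nat.choose_pos hr.2
    have h6 : (0 : ℝ) ≤ n.choose r := by positivity
    refine le_of_mul_le_mul_left ?_ h5
    calc _ = (n.choose r : ℝ) * (k.choose r * ∑ A ∈ Finset.powersetCard k Finset.univ, g A) := by
          ring
      _ ≤ n.choose r * ((n - r).choose (k - r) * ∑ d ∈ Finset.powersetCard r Finset.univ, f d) :=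
          mul_le_mul_of_nonneg_left h1 h6
      _ = _ := by rw [← mul_assoc, ← h4]; ring
  have hsum := Finset.sum_le_sum key
  rw [← Finset.sum_mul, ← Finset.mul_sum, ← sum_smallSets] at hsum
  have hN' : ∑ r ∈ Finset.Icc 1 k, (n.choose r : ℝ) = neighborCount n k := by
    simp [neighborCount]
  rw [hN'] at hsum
  rw [one_div_mul_eq_div, one_div_mul_eq_div, div_le_div_iff₀ hC hN]
  linarith

/-- The average of the projectors onto the pair states of `ψ`. -/
noncomputable def flipAverage (k : ℕ) (ψ : BitString n → ℂ) : Matrix (BitString n) (BitString n) ℂ :=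
  (1 / (neighborCount n k : ℝ)) • ∑ d ∈ smallSets n k, classProj ψ (flipPair d)

lemma flipAverage_posSemidef (k : ℕ) (ψ : BitString n → ℂ) : (flipAverage k ψ).PosSemidef := by
  refine Matrix.PosSemidef.smul ?_ (by positivity)
  exact Matrix.posSemidef_sum _ fun d _ => classProj_posSemidef ψ _

lemma flipAverage_mulVec_self {k : ℕ} (hk : 1 ≤ k) (hkn : k ≤ n) (ψ : BitString n → ℂ) :
    flipAverage k ψ *ᵥ ψ = ψ := by
  have hN : (neighborCount n k : ℝ) ≠ 0 := by exact_mod_cast (neighborCount_pos hk hkn).ne'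
  rw [flipAverage, smul_mulVec, sum_mulVec, Finset.sum_congr rfl fun d _ =>
    classProj_mulVec_self ψ (flipPair d), Finset.sum_const, ← Nat.cast_smul_eq_nsmul ℝ,
    card_smallSets, smul_smul, one_div_mul_cancel hN, one_smul]

/-- The bijection d ↔ x ⊕ d turns the sum over flips into a sum over the neighbours of `x`, the form
in which transition probabilities are given. -/
lemma flipAverage_apply (k : ℕ) (ψ : BitString n → ℂ) (x y : BitString n) :
    flipAverage k ψ x y = (1 / (neighborCount n k : ℝ) : ℝ) *
      ∑ z with z ≠ x ∧ hammingDist x z ≤ k, if y = x ∨ y = z then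
        ψ x * star (ψ y) / ((targetProb ψ x + targetProb ψ z : ℝ) : ℂ) else 0 := by
  classical
  rw [flipAverage, Matrix.smul_apply, Complex.real_smul, Matrix.sum_apply]
  congr 1
  refine Finset.sum_nbij' (fun d => flipBits d x) (fun z => diffSet x z) ?_ ?_ ?_ ?_ ?_
  · intro d hd
    simp only [smallSets, Finset.mem_filter, Finset.mem_univ, true_and] at hd ⊢
    rw [← card_diffSet, diffSet_flipBits]
    refine ⟨fun h => ?_, hd.2⟩
    have := diffSet_flipBits d x
    rw [h] at this
    simp [diffSet] at this
    simp [← this] at hd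
  · intro z hz
    simp only [smallSets, Finset.mem_filter, Finset.mem_univ, true_and] at hz ⊢
    rw [card_diffSet]
    exact ⟨hammingDist_pos.2 hz.1.symm, hz.2⟩
  · exact fun d _ => diffSet_flipBits d x
  · exact fun z _ => flipBits_diffSet x z
  · intro d hd
    simp only [smallSets, Finset.mem_filter, Finset.mem_univ, true_and] at hd
    simp only [classProj, of_apply, classWeight_flipPair ψ hd.1]
    exact if_congr Iff.rfl rfl rfl

/-! ### Similarity with the transition matrix and the spectral bound -/

lemma targetProb_eq_zero {ψ : BitString n → ℂ} {x : BitString n} : targetProb ψ x = 0 ↔ ψ x = 0 := by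
  simp [targetProb]

lemma sum_support {E : Type*} [AddCommMonoid E] (ψ : BitString n → ℂ) (f : BitString n → E)
    (h : ∀ x, targetProb ψ x = 0 → f x = 0) : ∑ x : Support ψ, f x = ∑ x, f x := by
  classical
  rw [← Finset.sum_subtype (Finset.univ.filter fun x => targetProb ψ x ≠ 0) (by simp),
    Finset.sum_filter_of_ne]
  exact fun x _ hx h0 => hx (h x h0)

/-- Off the diagonal, both sides equal ψ(x) π(y) / (N (π(x) + π(y))) for neighbours and 0 otherwise.
On the diagonal, each of the N neighbours z contributes the refusal probability π(x) / (π(x) + π(z))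
/ N; a z outside the support is always refused. -/
lemma mul_transitionMatrix_apply {k : ℕ} (hk : 1 ≤ k) (hkn : k ≤ n) (ψ : BitString n → ℂ)
    (x y : Support ψ) :
    ψ x * (transitionMatrix k ψ x y : ℂ) = flipAverage k ψ x y * ψ y := by
  have hN : (neighborCount n k : ℝ) ≠ 0 := by exact_mod_cast (neighborCount_pos hk hkn).ne'
  have hx : 0 < targetProb ψ x := lt_of_le_of_ne (by unfold targetProb; positivity) x.2.symm
  have hpos : ∀ z, 0 ≤ targetProb ψ z := fun z => by unfold targetProb; positivity
  rw [flipAverage_apply]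
  by_cases hxy : x = y
  · subst hxy
    have hS : (∑ z : Support ψ with z ≠ x, stepProb k ψ x z) =
        1 / (neighborCount n k : ℝ) * ∑ z with z ≠ (x : BitString n) ∧ hammingDist (x : BitString n) z ≤ k,
          targetProb ψ z / (targetProb ψ x + targetProb ψ z) := by
      rw [Finset.sum_filter, Finset.mul_sum, Finset.sum_filter]
      rw [← sum_support ψ]
      · refine Finset.sum_congr rfl fun z _ => ?_
        simp only [ne_eq, Subtype.ext_iff, stepProb, ite_and]
      · intro z hz
        simp [hz]
    have hcard : ((Finset.univ.filter fun z : BitString n => z ≠ x ∧ hammingDist (x : BitString n) z ≤ k).card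
        : ℝ) = neighborCount n k := by
      rw [← card_smallSets]
      congr 1
      refine Finset.card_nbij' (fun z => diffSet x z) (fun d => flipBits d x) ?_ ?_ ?_ ?_
      · intro z hz
        simp only [smallSets, Finset.coe_filter, Finset.mem_univ, true_and, Set.mem_ofPred_eq] at hz ⊢
        rw [card_diffSet]
        exact ⟨hammingDist_pos.2 hz.1.symm, hz.2⟩
      · intro d hd
        simp only [smallSets, Finset.coe_filter, Finset.mem_univ, true_and, Set.mem_ofPred_eq] at hd ⊢
        rw [← card_diffSet, diffSet_flipBits]
        refine ⟨fun h => ?_, hd.2⟩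
        have := diffSet_flipBits d (x : BitString n)
        rw [h] at this
        simp [diffSet] at this
        simp [← this] at hd
      · exact fun z _ => flipBits_diffSet _ z
      · exact fun d _ => diffSet_flipBits d _
    have hP : transitionMatrix k ψ x x = 1 / (neighborCount n k : ℝ) *
        ∑ z with z ≠ (x : BitString n) ∧ hammingDist (x : BitString n) z ≤ k,
          targetProb ψ x / (targetProb ψ x + targetProb ψ z) := by
      simp only [transitionMatrix, of_apply, if_true, hS]
      rw [sub_eq_iff_eq_add, ← mul_add, ← Finset.sum_add_distrib]
      rw [Finset.sum_congr rfl fun z _ => by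
        rw [← add_div, div_self (by have := hpos z; positivity)], Finset.sum_const, nsmul_eq_mul,
        mul_one, hcard, one_div_mul_cancel hN]
    rw [hP, mul_comm]
    push_cast
    congr 2
    refine Finset.sum_congr rfl fun z _ => ?_
    rw [if_pos (Or.inl rfl), RCLike.star_def, Complex.mul_conj']
    simp [targetProb]
  · have hne : (y : BitString n) ≠ x := fun h => hxy (Subtype.ext h.symm)
    simp only [transitionMatrix, of_apply, hxy, if_false, stepProb, hne, false_or]
    rw [Finset.sum_ite_eq]
    simp only [Finset.mem_filter, Finset.mem_univ, true_and, hne, ne_eq, not_false_eq_true]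
    split_ifs
    · have : star (ψ y) * ψ y = ((targetProb ψ y : ℝ) : ℂ) := by
        rw [RCLike.star_def, Complex.conj_mul']; simp [targetProb]
      push_cast
      rw [← this]
      ring
    · simp

/-- The diagonal matrix of amplitudes is invertible on the support and conjugates one matrix into
the other. -/
lemma charpoly_transitionMatrix {k : ℕ} (hk : 1 ≤ k) (hkn : k ≤ n) (ψ : BitString n → ℂ) :
    ((transitionMatrix k ψ).map Complex.ofRealHom).charpoly =
      ((flipAverage k ψ).submatrix (Subtype.val : Support ψ → _) Subtype.val).charpoly := by
  classical
  set D : Matrix (Support ψ) (Support ψ) ℂ := diagonal fun x => ψ x with hD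
  have h0 : ∀ x : Support ψ, ψ x ≠ 0 := fun x h => x.2 (targetProb_eq_zero.2 h)
  have hDD : D * diagonal (fun x : Support ψ => (ψ x)⁻¹) = 1 := by
    rw [hD, diagonal_mul_diagonal, ← diagonal_one]
    congr 1; funext x; exact mul_inv_cancel₀ (h0 x)
  have hcomm : D * (transitionMatrix k ψ).map Complex.ofRealHom =
      (flipAverage k ψ).submatrix (Subtype.val : Support ψ → _) Subtype.val * D := by
    ext x y
    rw [hD, diagonal_mul, mul_diagonal]
    exact mul_transitionMatrix_apply hk hkn ψ x y
  have hDD' := mul_eq_one_comm.1 hDD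
  rw [← one_mul ((transitionMatrix k ψ).map Complex.ofRealHom), ← hDD', mul_assoc, hcomm,
    charpoly_mul_comm, mul_assoc, hDD, mul_one]

lemma dotProduct_mulVec_support (ψ φ : BitString n → ℂ) (k : ℕ) :
    star (fun x : Support ψ => φ x) ⬝ᵥ
      ((flipAverage k ψ).submatrix (Subtype.val : Support ψ → _) Subtype.val *ᵥ
        fun x : Support ψ => φ x) = star φ ⬝ᵥ (flipAverage k ψ *ᵥ φ) := by
  have hrow : ∀ x y, ψ x = 0 ∨ ψ y = 0 → flipAverage k ψ x y = 0 := by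
    rintro x y (h | h) <;> simp [flipAverage_apply, h]
  simp only [dotProduct, mulVec, submatrix_apply, Pi.star_apply]
  rw [← sum_support ψ]
  · refine Finset.sum_congr rfl fun x _ => ?_
    rw [← sum_support ψ]
    intro y hy
    rw [hrow _ _ (Or.inr (targetProb_eq_zero.1 hy)), zero_mul]
  · intro x hx
    rw [Finset.sum_eq_zero fun y _ => by rw [hrow _ _ (Or.inl (targetProb_eq_zero.1 hx)), zero_mul],
      mul_zero]

lemma flipAverage_spectral_bound {k : ℕ} (hk : 1 ≤ k) (hkn : k ≤ n) {ψ : BitString n → ℂ}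
    (hψ : IsPureState ψ) (hl : secondEigenvalue k ψ < 1) :
    0 ≤ secondEigenvalue k ψ ∧
    ∀ φ : BitString n → ℂ, (star φ ⬝ᵥ (flipAverage k ψ *ᵥ φ)).re ≤ ‖star ψ ⬝ᵥ φ‖ ^ 2 +
      secondEigenvalue k ψ * (∑ x, ‖φ x‖ ^ 2 - ‖star ψ ⬝ᵥ φ‖ ^ 2) := by
  have hnorm : ∑ x : Support ψ, ‖ψ x‖ ^ 2 = 1 := by
    rw [sum_support ψ (fun x => ‖ψ x‖ ^ 2) fun x hx => hx]
    exact hψ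
  have hne : Nonempty (Support ψ) := by
    by_contra h
    rw [not_nonempty_iff] at h
    simp at hnorm
  have hv : (flipAverage k ψ).submatrix (Subtype.val : Support ψ → _) Subtype.val *ᵥ
      (fun x : Support ψ => ψ x) = fun x : Support ψ => ψ x := by
    funext x
    refine Eq.trans ?_ (congrFun (flipAverage_mulVec_self hk hkn ψ) x)
    simp only [mulVec, dotProduct, submatrix_apply]
    rw [sum_support ψ fun y => flipAverage k ψ x y * ψ y]
    intro y hy
    rw [targetProb_eq_zero.1 hy, mul_zero]
  obtain ⟨h0, hbound⟩ := spectral_bound ((flipAverage_posSemidef k ψ).submatrix Subtype.val)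
    (charpoly_transitionMatrix hk hkn ψ) hnorm hv hl
  refine ⟨h0, fun φ => ?_⟩
  have h := hbound fun x => φ x
  rw [dotProduct_mulVec_support] at h
  have hover : (star (fun x : Support ψ => ψ x) ⬝ᵥ fun x : Support ψ => φ x) = star ψ ⬝ᵥ φ := by
    simp only [dotProduct, Pi.star_apply]
    exact sum_support ψ (fun x => star (ψ x) * φ x) fun x hx => by simp [targetProb_eq_zero.1 hx]
  rw [hover] at h
  -- Extending `φ` beyond the support only increases its norm, which weakens the bound because λ₁ ≥
  -- 0.
  refine h.trans (add_le_add le_rfl (mul_le_mul_of_nonneg_left (sub_le_sub_right ?_ _) h0))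
  rw [← Finset.sum_subtype (p := fun x => targetProb ψ x ≠ 0)
    (Finset.univ.filter fun x => targetProb ψ x ≠ 0) (by simp) fun x => ‖φ x‖ ^ 2]
  exact Finset.sum_le_sum_of_subset_of_nonneg (Finset.subset_univ _) fun _ _ _ => by positivity

/-! ### Trace inequalities against the state -/

lemma re_trace_mul_vecMulVec (ρ : Matrix (BitString n) (BitString n) ℂ) (ψ : BitString n → ℂ) :
    (ρ * vecMulVec ψ (star ψ)).trace.re = fidelity ρ ψ := by
  rw [mul_vecMulVec, trace_vecMulVec, dotProduct_comm, fidelity]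

lemma classProj_top {ψ : BitString n → ℂ} (hψ : IsPureState ψ) :
    classProj ψ ⊤ = vecMulVec ψ (star ψ) := by
  ext x y
  have : classWeight ψ ⊤ x = 1 := by
    have h : ∑ x, ‖ψ x‖ ^ 2 = 1 := hψ
    simpa [classWeight, Setoid.top_def] using h
  simp [classProj, vecMulVec_apply, Setoid.top_def, this]

lemma fidelity_nonneg {ρ : Matrix (BitString n) (BitString n) ℂ} (hρ : ρ.PosSemidef)
    (φ : BitString n → ℂ) : 0 ≤ fidelity ρ φ :=
  (Complex.le_def.1 (hρ.dotProduct_mulVec_nonneg φ)).1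

lemma re_trace_mul_flipAverage_le {k : ℕ} (hk : 1 ≤ k) (hkn : k ≤ n)
    {ρ : Matrix (BitString n) (BitString n) ℂ} (hρ : IsState ρ) {ψ : BitString n → ℂ}
    (hψ : IsPureState ψ) (hl : secondEigenvalue k ψ < 1) :
    (ρ * flipAverage k ψ).trace.re ≤
      fidelity ρ ψ + secondEigenvalue k ψ * (1 - fidelity ρ ψ) := by
  obtain ⟨-, hb⟩ := flipAverage_spectral_bound hk hkn hψ hl
  set lam := secondEigenvalue k ψ
  have h := re_trace_mul_nonneg hρ.1 (G := ((1 - lam : ℝ) : ℂ) • vecMulVec ψ (star ψ) +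
    (lam : ℂ) • (1 : Matrix (BitString n) (BitString n) ℂ) - flipAverage k ψ) fun φ => by
      have hq : (star φ ⬝ᵥ (vecMulVec ψ (star ψ) *ᵥ φ)) = ((‖star ψ ⬝ᵥ φ‖ ^ 2 : ℝ) : ℂ) := by
        have h1 : star φ ⬝ᵥ ψ = star (star ψ ⬝ᵥ φ) := by
          rw [star_dotProduct]
        rw [vecMulVec_mulVec, op_smul_eq_smul, dotProduct_smul, smul_eq_mul, h1, RCLike.star_def,
          Complex.mul_conj']
        push_cast; rfl
      rw [sub_mulVec, add_mulVec, smul_mulVec, smul_mulVec, one_mulVec, dotProduct_sub,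
        dotProduct_add, dotProduct_smul, dotProduct_smul, hq, star_dotProduct_self_eq_sum,
        smul_eq_mul, smul_eq_mul, Complex.sub_re, Complex.add_re, Complex.re_ofReal_mul,
        Complex.re_ofReal_mul, Complex.ofReal_re, Complex.ofReal_re]
      linarith [hb φ]
  rw [mul_sub, mul_add, trace_sub, trace_add, Matrix.mul_smul, Matrix.mul_smul, mul_one, trace_smul, trace_smul,
    hρ.2, Complex.sub_re, Complex.add_re, smul_eq_mul, smul_eq_mul, Complex.re_ofReal_mul,
    Complex.re_ofReal_mul, re_trace_mul_vecMulVec, Complex.one_re] at h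
  linarith

lemma average_classProj_agreeOff_le {k : ℕ} (hk : 1 ≤ k) (hkn : k ≤ n)
    {ρ : Matrix (BitString n) (BitString n) ℂ} (hρ : ρ.PosSemidef) (ψ : BitString n → ℂ) :
    1 / (n.choose k : ℝ) * ∑ A ∈ Finset.powersetCard k Finset.univ,
      (ρ * classProj ψ (agreeOff A)).trace.re ≤ (ρ * flipAverage k ψ).trace.re := by
  refine (average_le_average hk hkn _ (fun d => (ρ * classProj ψ (flipPair d)).trace.re)
    fun d A h => re_trace_mul_classProj_le hρ ψ (flipPair_le_agreeOff h)).trans_eq ?_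
  rw [flipAverage, Matrix.mul_smul, trace_smul, Complex.smul_re, Matrix.mul_sum,
    trace_sum, Complex.re_sum, smul_eq_mul]

lemma fidelity_le_average_classProj {k : ℕ} (hkn : k ≤ n)
    {ρ : Matrix (BitString n) (BitString n) ℂ} (hρ : ρ.PosSemidef) {ψ : BitString n → ℂ}
    (hψ : IsPureState ψ) :
    fidelity ρ ψ ≤ 1 / (n.choose k : ℝ) * ∑ A ∈ Finset.powersetCard k Finset.univ,
      (ρ * classProj ψ (agreeOff A)).trace.re := by
  have hC : (0 : ℝ) < n.choose k := by exact_mod_cast Nat.choose_pos hkn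
  rw [one_div_mul_eq_div, le_div_iff₀ hC, ← re_trace_mul_vecMulVec, ← classProj_top hψ]
  have := Finset.card_nsmul_le_sum (Finset.powersetCard k (Finset.univ : Finset (Fin n)))
    (fun A => (ρ * classProj ψ (agreeOff A)).trace.re) _
    fun A _ => re_trace_mul_classProj_le hρ ψ le_top
  rw [Finset.card_powersetCard, Finset.card_univ, Fintype.card_fin, nsmul_eq_mul] at this
  linarith

end FidelityEstimation

/-! ### Random Pauli measurements and the law of a round -/

namespace FidelityEstimation

lemma sum_pauli {E : Type*} [AddCommMonoid E] (f : Pauli → E) :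
    ∑ P, f P = f .X + (f .Y + f .Z) := by
  change ∑ P ∈ ({Pauli.X, Pauli.Y, Pauli.Z} : Finset Pauli), f P = _
  rw [Finset.sum_insert (by simp), Finset.sum_pair (by simp)]

lemma inv_sqrt_two_mul_self : ((Real.sqrt 2 : ℂ))⁻¹ * ((Real.sqrt 2 : ℂ))⁻¹ = 1 / 2 := by
  rw [← mul_inv, ← Complex.ofReal_mul, Real.mul_self_sqrt (by norm_num)]
  norm_num

/-- The eigenstates of a Pauli operator resolve the identity. -/
lemma sum_eigenstate_mul_star (P : Pauli) (x y : Bool) :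
    ∑ s, P.eigenstate s x * star (P.eigenstate s y) = if x = y then 1 else 0 := by
  have h := inv_sqrt_two_mul_self
  have hI := Complex.I_mul_I
  cases P <;> cases x <;> cases y <;>
    simp [Pauli.eigenstate, div_eq_mul_inv] <;>
    first
    | linear_combination 2 * h
    | linear_combination 2 * h - 2 * ((Real.sqrt 2 : ℂ))⁻¹ * ((Real.sqrt 2 : ℂ))⁻¹ * hI

/-- The single-qubit shadow reconstructs the matrix units from random Pauli measurements. -/
lemma sum_pauli_shadow (x y a b : Bool) :
    ∑ P : Pauli, ∑ s, (1 / 3 : ℂ) * (star (P.eigenstate s x) * P.eigenstate s y) *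
      (3 * P.eigenstate s a * star (P.eigenstate s b) - if a = b then 1 else 0) =
      (if a = x then 1 else 0) * if b = y then 1 else 0 := by
  have h := inv_sqrt_two_mul_self
  rw [sum_pauli]
  cases x <;> cases y <;> cases a <;> cases b <;>
    simp [Pauli.eigenstate, div_eq_mul_inv] <;>
    -- Each case is a polynomial identity in c = 1/√2 and I, so it is settled by the values of c²,
    -- c⁴, I² and I⁴.
    generalize ((Real.sqrt 2 : ℂ))⁻¹ = c at h ⊢ <;>
    have h2 : c ^ 2 = 1 / 2 := (sq c).trans h <;>
    have h4 : c ^ 4 = 1 / 4 := by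
      rw [show c ^ 4 = c ^ 2 * c ^ 2 by ring, h2]; norm_num
  all_goals ring_nf
  all_goals try simp only [h2, h4, Complex.I_sq, Complex.I_pow_four]
  all_goals try ring_nf

variable {n : ℕ}

lemma sum_round {E : Type*} [AddCommMonoid E] (f : Round n → E) :
    ∑ r, f r = ∑ A, ∑ b, ∑ o, f ⟨A, b, o⟩ := by
  rw [← Fintype.sum_equiv (⟨fun p => ⟨p.1, p.2.1, p.2.2⟩, fun r => (r.A, r.basis, r.outcome),
      fun _ => rfl, fun _ => rfl⟩ : Finset (Fin n) × (Fin n → Pauli) × BitString n ≃ Round n)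
      (fun p => f ⟨p.1, p.2.1, p.2.2⟩) f fun _ => rfl, Fintype.sum_prod_type]
  simp only [Fintype.sum_prod_type]

lemma sum_rotate {α β γ E : Type*} [Fintype α] [Fintype β] [Fintype γ] [AddCommMonoid E]
    (f : α → β → γ → E) : ∑ a, ∑ b, ∑ c, f a b c = ∑ c, ∑ a, ∑ b, f a b c := by
  rw [Finset.sum_congr rfl fun a _ => Finset.sum_comm, Finset.sum_comm]

lemma sum_prod_eq_prod_sum {ι κ : Type*} [Fintype ι] [DecidableEq ι] [Fintype κ]
    (g : ι → κ → ℂ) : ∑ f : ι → κ, ∏ i, g i (f i) = ∏ i, ∑ j, g i j := by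
  rw [Finset.prod_univ_sum, Fintype.piFinset_univ]

lemma prod_ite_eq_ite {ι κ : Type*} [Fintype ι] [DecidableEq κ] (x y : ι → κ) [Decidable (x = y)] :
    (∏ i, if x i = y i then (1 : ℂ) else 0) = if x = y then 1 else 0 := by
  rw [Finset.prod_ite_zero]
  simp [funext_iff]

/-- Products of eigenstates resolve the identity. -/
lemma sum_prod_eigenstate_mul_star {ι : Type*} [Fintype ι] [DecidableEq ι] (b : ι → Pauli)
    (x y : ι → Bool) :
    ∑ o : ι → Bool, (∏ q, (b q).eigenstate (o q) (x q)) *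
      star (∏ q, (b q).eigenstate (o q) (y q)) = if x = y then 1 else 0 := by
  simp only [star_prod, ← Finset.prod_mul_distrib]
  rw [sum_prod_eq_prod_sum fun q s => (b q).eigenstate s (x q) * star ((b q).eigenstate s (y q))]
  simp only [sum_eigenstate_mul_star]
  exact prod_ite_eq_ite x y

lemma star_dotProduct_mulVec_eq_sum {ι : Type*} [Fintype ι] (G : Matrix ι ι ℂ) (φ : ι → ℂ) :
    star φ ⬝ᵥ (G *ᵥ φ) = ∑ x, ∑ y, G x y * (star (φ x) * φ y) := by
  simp only [dotProduct, mulVec, Pi.star_apply, Finset.mul_sum]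
  refine Finset.sum_congr rfl fun x _ => Finset.sum_congr rfl fun y _ => by ring

lemma ofReal_fidelity {ρ : Matrix (BitString n) (BitString n) ℂ} (hρ : ρ.PosSemidef)
    (φ : BitString n → ℂ) : (fidelity ρ φ : ℂ) = star φ ⬝ᵥ (ρ *ᵥ φ) := by
  have := (Complex.le_def.1 (hρ.dotProduct_mulVec_nonneg φ)).2
  exact Complex.ext (by simp [fidelity]) (by simpa using this)

lemma sum_fidelity_productState {ρ : Matrix (BitString n) (BitString n) ℂ} (hρ : IsState ρ)
    (A : Finset (Fin n)) (b : Fin n → Pauli) :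
    ∑ o, fidelity ρ (Round.productState ⟨A, b, o⟩) = 1 := by
  have h : ∑ o, ((fidelity ρ (Round.productState ⟨A, b, o⟩) : ℝ) : ℂ) = 1 := by
    simp only [ofReal_fidelity hρ.1, star_dotProduct_mulVec_eq_sum]
    rw [Finset.sum_comm]
    rw [← hρ.2, Matrix.trace]
    refine Finset.sum_congr rfl fun x _ => ?_
    rw [Finset.sum_comm, Finset.sum_eq_single x]
    · rw [← Finset.mul_sum]
      simp only [Round.productState, mul_comm (star _), sum_prod_eigenstate_mul_star]
      simp
    · intro y _ hy
      rw [← Finset.mul_sum]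
      simp only [Round.productState, mul_comm (star _), sum_prod_eigenstate_mul_star]
      simp [hy]
    · simp
  exact_mod_cast h

/-- The probability of the bases of a round with measured subset `A`. -/
noncomputable def basisProb (A : Finset (Fin n)) (b : Fin n → Pauli) : ℝ :=
  ∏ q, if q ∈ A then (1 / 3 : ℝ) else if b q = Pauli.Z then 1 else 0

lemma roundProb_mk (k : ℕ) (ρ : Matrix (BitString n) (BitString n) ℂ) (A : Finset (Fin n))
    (b : Fin n → Pauli) (o : BitString n) :
    roundProb k ρ ⟨A, b, o⟩ = (if A.card = k then 1 / (n.choose k : ℝ) else 0) * basisProb A b *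
      fidelity ρ (Round.productState ⟨A, b, o⟩) :=
  rfl

lemma sum_basisProb (A : Finset (Fin n)) : ∑ b, basisProb A b = 1 := by
  unfold basisProb
  have := Finset.prod_univ_sum (fun _ : Fin n => (Finset.univ : Finset Pauli))
    fun q P => if q ∈ A then (1 / 3 : ℝ) else if P = Pauli.Z then 1 else 0
  rw [Fintype.piFinset_univ] at this
  rw [← this]
  refine Finset.prod_eq_one fun q _ => ?_
  rw [sum_pauli]
  split_ifs <;> simp_all
  norm_num

lemma sum_if_card {k : ℕ} (f : Finset (Fin n) → ℝ) :
    ∑ A : Finset (Fin n), (if A.card = k then 1 / (n.choose k : ℝ) else 0) * f A =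
      1 / (n.choose k : ℝ) * ∑ A ∈ Finset.powersetCard k Finset.univ, f A := by
  rw [Finset.mul_sum, Finset.powersetCard_eq_filter, Finset.powerset_univ, Finset.sum_filter]
  simp only [ite_mul, zero_mul]

lemma roundProb_nonneg (k : ℕ) {ρ : Matrix (BitString n) (BitString n) ℂ} (hρ : ρ.PosSemidef)
    (r : Round n) : 0 ≤ roundProb k ρ r := by
  unfold roundProb
  refine mul_nonneg (mul_nonneg ?_ (Finset.prod_nonneg fun q _ => ?_)) (fidelity_nonneg hρ _) <;>
    split_ifs <;> positivity

lemma sum_roundProb {k : ℕ} (hkn : k ≤ n) {ρ : Matrix (BitString n) (BitString n) ℂ}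
    (hρ : IsState ρ) : ∑ r, roundProb k ρ r = 1 := by
  have hC : (n.choose k : ℝ) ≠ 0 := by exact_mod_cast (Nat.choose_pos hkn).ne'
  rw [sum_round]
  have hA : ∀ A : Finset (Fin n), ∑ b, ∑ o, roundProb k ρ ⟨A, b, o⟩ =
      (if A.card = k then 1 / (n.choose k : ℝ) else 0) * ∑ b, basisProb A b := by
    intro A
    rw [Finset.mul_sum]
    refine Finset.sum_congr rfl fun b _ => ?_
    simp only [roundProb_mk]
    rw [← Finset.mul_sum, sum_fidelity_productState hρ, mul_one]
  simp only [hA, sum_basisProb]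
  rw [sum_if_card]
  simp [hC]

lemma isProbabilityMeasure_roundLaw {k : ℕ} (hkn : k ≤ n)
    {ρ : Matrix (BitString n) (BitString n) ℂ} (hρ : IsState ρ) :
    IsProbabilityMeasure (roundLaw k ρ) := by
  constructor
  simp only [roundLaw, Measure.finsetSum_apply, Measure.smul_apply, measure_univ, smul_eq_mul,
    mul_one]
  rw [← ENNReal.ofReal_sum_of_nonneg fun r _ => roundProb_nonneg k hρ.1 r, sum_roundProb hkn hρ,
    ENNReal.ofReal_one]

lemma integral_roundLaw (k : ℕ) {ρ : Matrix (BitString n) (BitString n) ℂ} (hρ : ρ.PosSemidef)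
    (f : Round n → ℝ) : ∫ r, f r ∂roundLaw k ρ = ∑ r, roundProb k ρ r * f r := by
  unfold roundLaw
  rw [integral_finsetSum_measure fun r _ => (integrable_dirac (by simp)).smul_measure (by simp)]
  refine Finset.sum_congr rfl fun r _ => ?_
  rw [integral_smul_measure, integral_dirac, ENNReal.toReal_ofReal (roundProb_nonneg k hρ r),
    smul_eq_mul]

lemma ae_card_roundLaw (k : ℕ) (ρ : Matrix (BitString n) (BitString n) ℂ) :
    ∀ᵐ r ∂roundLaw k ρ, r.A.card = k := by
  unfold roundLaw
  rw [ae_iff, Measure.finsetSum_apply]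
  refine Finset.sum_eq_zero fun r _ => ?_
  by_cases h : r.A.card = k
  · simp [h]
  · simp [roundProb, h]

lemma sum_norm_reducedState_le_one (ψ : BitString n → ℂ) (r : Round n) :
    ∑ x, ‖reducedState ψ r x‖ ^ 2 ≤ 1 := by
  simp only [reducedState, norm_div, div_pow, Complex.norm_real, Real.norm_eq_abs, sq_abs]
  rw [Real.sq_sqrt (by positivity), ← Finset.sum_div]
  exact div_self_le_one _

/-- The shadow is diagonal in the product basis of the measured Paulis. Each factor 3|s⟩⟨s| - I has
eigenvalues 2 and -1, so the operator norm is at most 2^|A|, and the reduced state has norm at most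
1. -/
lemma abs_localOverlap_le (ψ : BitString n → ℂ) (r : Round n) :
    |localOverlap ψ r| ≤ 2 ^ r.A.card := by
  set φ := reducedState ψ r with hφ
  set e : (r.A → Bool) → (r.A → Bool) → ℂ :=
    fun t x => ∏ q : r.A, (r.basis q).eigenstate (t q) (x q) with he
  set c : (r.A → Bool) → ℝ := fun t => ∏ q : r.A, if t q = r.outcome q then 2 else -1 with hc
  have hshadow : ∀ x y, localShadow r x y = ∑ t, (c t : ℂ) * (e t x * star (e t y)) := by
    intro x y
    simp only [localShadow, of_apply, hc, he, star_prod, Complex.ofReal_prod,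
      ← Finset.prod_mul_distrib]
    rw [sum_prod_eq_prod_sum fun (q : r.A) s =>
      (((if s = r.outcome q then 2 else -1 : ℝ) : ℝ) : ℂ) *
      ((r.basis q).eigenstate s (x q) * star ((r.basis q).eigenstate s (y q)))]
    refine Finset.prod_congr rfl fun q _ => ?_
    rw [← sum_eigenstate_mul_star (r.basis q) (x q) (y q)]
    simp only [Fintype.sum_bool]
    cases r.outcome q <;> simp <;> ring
  have hov : localOverlap ψ r = ∑ t, c t * ‖star (e t) ⬝ᵥ φ‖ ^ 2 := by
    have h1 : star φ ⬝ᵥ (localShadow r *ᵥ φ) =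
        ((∑ t, c t * ‖star (e t) ⬝ᵥ φ‖ ^ 2 : ℝ) : ℂ) := by
      rw [star_dotProduct_mulVec_eq_sum]
      push_cast
      simp only [hshadow, Finset.sum_mul, ← Complex.conj_mul', dotProduct, Pi.star_apply, map_sum,
        Finset.mul_sum]
      rw [Finset.sum_congr rfl fun x _ => Finset.sum_comm, Finset.sum_comm]
      refine Finset.sum_congr rfl fun t _ => ?_
      rw [Finset.sum_comm]
      refine Finset.sum_congr rfl fun x _ => Finset.sum_congr rfl fun y _ => ?_
      simp only [RCLike.star_def, map_mul, Complex.conj_conj]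
      ring
    rw [localOverlap, ← hφ, h1, Complex.ofReal_re]
  have hpars : ∑ t, ‖star (e t) ⬝ᵥ φ‖ ^ 2 = ∑ x, ‖φ x‖ ^ 2 := by
    have h1 : ((∑ t, ‖star (e t) ⬝ᵥ φ‖ ^ 2 : ℝ) : ℂ) = ((∑ x, ‖φ x‖ ^ 2 : ℝ) : ℂ) := by
      push_cast
      simp only [← Complex.conj_mul', dotProduct, Pi.star_apply, map_sum, Finset.mul_sum,
        Finset.sum_mul]
      rw [Finset.sum_comm]
      refine Finset.sum_congr rfl fun x _ => ?_
      rw [Finset.sum_comm, Finset.sum_eq_single x]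
      · simp only [RCLike.star_def, map_mul, Complex.conj_conj]
        have := sum_prod_eigenstate_mul_star (fun q : r.A => r.basis q) x x
        rw [if_pos rfl] at this
        rw [← one_mul ((starRingEnd ℂ) (φ x) * φ x), ← this, Finset.sum_mul]
        refine Finset.sum_congr rfl fun t _ => ?_
        simp only [he, RCLike.star_def]
        ring
      · intro y _ hy
        have := sum_prod_eigenstate_mul_star (fun q : r.A => r.basis q) y x
        rw [if_neg hy] at this
        rw [← zero_mul ((starRingEnd ℂ) (φ y) * φ x), ← this, Finset.sum_mul]
        refine Finset.sum_congr rfl fun t _ => ?_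
        simp only [he, RCLike.star_def, map_mul, Complex.conj_conj]
        ring
      · simp
    exact_mod_cast h1
  have hcb : ∀ t, |c t| ≤ 2 ^ r.A.card := by
    intro t
    rw [hc, Finset.abs_prod]
    refine (Finset.prod_le_prod (fun _ _ => abs_nonneg _) (g := fun _ => (2 : ℝ)) fun q _ => ?_).trans
      (by simp)
    split_ifs <;> norm_num
  rw [hov]
  calc |∑ t, c t * ‖star (e t) ⬝ᵥ φ‖ ^ 2| ≤ ∑ t, |c t * ‖star (e t) ⬝ᵥ φ‖ ^ 2| :=
        Finset.abs_sum_le_sum_abs _ _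
    _ ≤ ∑ t, 2 ^ r.A.card * ‖star (e t) ⬝ᵥ φ‖ ^ 2 := by
        refine Finset.sum_le_sum fun t _ => ?_
        rw [abs_mul, abs_of_nonneg (by positivity : 0 ≤ ‖star (e t) ⬝ᵥ φ‖ ^ 2)]
        exact mul_le_mul_of_nonneg_right (hcb t) (by positivity)
    _ ≤ 2 ^ r.A.card := by
        rw [← Finset.mul_sum, hpars]
        exact mul_le_of_le_one_right (by positivity) (sum_norm_reducedState_le_one ψ r)

/-! ### The expectation of the local overlap -/

lemma insertBits_restrict {A : Finset (Fin n)} {x y : BitString n} (h : agreeOff A x y) :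
    insertBits A (fun q => y q) x = y := by
  funext q
  by_cases hq : q ∈ A
  · simp [insertBits, hq]
  · simp [insertBits, hq, h q hq]

lemma insertBits_congr {A : Finset (Fin n)} {x y : BitString n} (h : agreeOff A x y)
    (a : A → Bool) : insertBits A a x = insertBits A a y := by
  funext q
  by_cases hq : q ∈ A
  · simp [insertBits, hq]
  · simp [insertBits, hq, h q hq]

lemma agreeOff_insertBits (A : Finset (Fin n)) (x : BitString n) (a : A → Bool) :
    agreeOff A x (insertBits A a x) := by
  intro q hq
  simp [insertBits, hq]

lemma sum_insertBits (ψ : BitString n → ℂ) (A : Finset (Fin n)) (x : BitString n) :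
    ∑ a : A → Bool, ‖ψ (insertBits A a x)‖ ^ 2 = classWeight ψ (agreeOff A) x := by
  classical
  unfold classWeight
  refine Finset.sum_nbij' (fun a => insertBits A a x) (fun w q => w q) ?_ ?_ ?_ ?_ ?_
  · intro a _
    simpa using agreeOff_insertBits A x a
  · simp
  · intro a _
    funext q
    simp [insertBits]
  · intro w hw
    exact insertBits_restrict (by simpa using hw)
  · exact fun _ _ => rfl

/-- The normalized reduced state as a function of the measured subset and the outcome. -/
noncomputable def conditionalState (ψ : BitString n → ℂ) (A : Finset (Fin n)) (x : BitString n)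
    (a : A → Bool) : ℂ :=
  ψ (insertBits A a x) / (Real.sqrt (classWeight ψ (agreeOff A) x) : ℂ)

lemma reducedState_eq (ψ : BitString n → ℂ) (A : Finset (Fin n)) (b : Fin n → Pauli)
    (x : BitString n) : reducedState ψ ⟨A, b, x⟩ = conditionalState ψ A x := by
  funext a
  simp only [reducedState, reducedAmp, conditionalState, sum_insertBits]

lemma conditionalState_congr (ψ : BitString n → ℂ) {A : Finset (Fin n)} {x y : BitString n}
    (h : agreeOff A x y) : conditionalState ψ A x = conditionalState ψ A y := by
  funext a
  rw [conditionalState, conditionalState, insertBits_congr h, classWeight_congr ψ h]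

lemma star_conditionalState_mul (ψ : BitString n → ℂ) {A : Finset (Fin n)} {x y : BitString n}
    (h : agreeOff A x y) :
    star (conditionalState ψ A x fun q => x q) * conditionalState ψ A x (fun q => y q) =
      ψ y * star (ψ x) / (classWeight ψ (agreeOff A) x : ℂ) := by
  have hW : 0 ≤ classWeight ψ (agreeOff A) x := by unfold classWeight; positivity
  rw [conditionalState, conditionalState, insertBits_restrict h,
    insertBits_restrict ((agreeOff A).refl x), star_div₀, div_mul_div_comm, RCLike.star_def,
    Complex.conj_ofReal, ← Complex.ofReal_mul, Real.mul_self_sqrt hW, mul_comm]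

/-- Expanded in matrix entries, the sum factorizes over the qubits. In A, shadow inversion picks out
the matrix unit at the bits of `x` and `y`; off A, the Z measurement forces these bits to agree. -/
lemma sum_shadow_localOverlap (ψ : BitString n → ℂ) (A : Finset (Fin n)) (x y : BitString n) :
    ∑ b, ∑ o, (basisProb A b : ℂ) *
      (star (Round.productState ⟨A, b, o⟩ x) * Round.productState ⟨A, b, o⟩ y) *
      (star (reducedState ψ ⟨A, b, o⟩) ⬝ᵥ
        (localShadow ⟨A, b, o⟩ *ᵥ reducedState ψ ⟨A, b, o⟩)) =
      classProj ψ (agreeOff A) y x := by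
  classical
  set G : (A → Bool) → (A → Bool) → Fin n → Pauli → Bool → ℂ := fun a a' q P s =>
    if h : q ∈ A then (1 / 3 : ℂ) * (star (P.eigenstate s (x q)) * P.eigenstate s (y q)) *
      (3 * P.eigenstate s (a ⟨q, h⟩) * star (P.eigenstate s (a' ⟨q, h⟩)) -
        if a ⟨q, h⟩ = a' ⟨q, h⟩ then 1 else 0)
    else (if P = Pauli.Z then 1 else 0) * (star (P.eigenstate s (x q)) * P.eigenstate s (y q))
    with hG
  have hprod : ∀ b o a a', (basisProb A b : ℂ) *
      (star (Round.productState ⟨A, b, o⟩ x) * Round.productState ⟨A, b, o⟩ y) *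
      localShadow ⟨A, b, o⟩ a a' = ∏ q, G a a' q (b q) (o q) := by
    intro b o a a'
    have hshadow : localShadow ⟨A, b, o⟩ a a' = _ :=
      Finset.prod_attach_eq_prod_dite A fun q : A =>
        3 * (b q).eigenstate (o q) (a q) * star ((b q).eigenstate (o q) (a' q)) -
          if a q = a' q then (1 : ℂ) else 0
    rw [hshadow]
    simp only [Round.productState, basisProb, star_prod, Complex.ofReal_prod]
    rw [← Finset.prod_mul_distrib, ← Finset.prod_mul_distrib,
      ← Finset.prod_mul_distrib]
    refine Finset.prod_congr rfl fun q _ => ?_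
    by_cases hq : q ∈ A
    · simp [hG, hq]
    · by_cases hZ : b q = Pauli.Z <;> simp [hG, hq, hZ]
  have hterm : ∀ b o, (basisProb A b : ℂ) *
      (star (Round.productState ⟨A, b, o⟩ x) * Round.productState ⟨A, b, o⟩ y) *
      (star (reducedState ψ ⟨A, b, o⟩) ⬝ᵥ
        (localShadow ⟨A, b, o⟩ *ᵥ reducedState ψ ⟨A, b, o⟩)) =
      ∑ a, ∑ a', (∏ q, G a a' q (b q) (o q)) *
        (star (conditionalState ψ A x a) * conditionalState ψ A x a') := by
    intro b o
    rw [star_dotProduct_mulVec_eq_sum, reducedState_eq, Finset.mul_sum]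
    refine Finset.sum_congr rfl fun a _ => ?_
    rw [Finset.mul_sum]
    refine Finset.sum_congr rfl fun a' _ => ?_
    rw [← mul_assoc, hprod]
    by_cases h : agreeOff A x o
    · rw [conditionalState_congr ψ h]
    · obtain ⟨q, hq, hne⟩ : ∃ q, q ∉ A ∧ x q ≠ o q := by
        by_contra hcon
        push Not at hcon
        exact h hcon
      -- The reduced state depends on `o` only off A. Where `o` differs from `x` there, the Z-basis
      -- factor kills the term, so the reduced state may be taken at `x`, which decouples it from
      -- the sum over outcomes.
      have h0 : G a a' q (b q) (o q) = 0 := by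
        simp only [hG, hq, dite_false]
        by_cases hZ : b q = Pauli.Z
        · simp [hZ, Pauli.eigenstate, hne]
        · simp [hZ]
      rw [Finset.prod_eq_zero (Finset.mem_univ q) h0, zero_mul, zero_mul]
  have hsum : ∀ a a', ∑ b : Fin n → Pauli, ∑ o : BitString n, ∏ q, G a a' q (b q) (o q) =
      if agreeOff A x y then
        (if a = fun q : A => x q then 1 else 0) * (if a' = fun q : A => y q then 1 else 0) else 0 := by
    intro a a'
    have h1 : ∀ b : Fin n → Pauli, ∑ o : BitString n, ∏ q, G a a' q (b q) (o q) =
        ∏ q, ∑ s, G a a' q (b q) s := fun b => sum_prod_eq_prod_sum fun q s => G a a' q (b q) s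
    simp only [h1]
    rw [sum_prod_eq_prod_sum fun q P => ∑ s, G a a' q P s]
    have hin : ∀ q (h : q ∈ A), ∑ P, ∑ s, G a a' q P s =
        (if a ⟨q, h⟩ = x q then 1 else 0) * if a' ⟨q, h⟩ = y q then 1 else 0 := by
      intro q h
      simp only [hG, h, dite_true]
      exact sum_pauli_shadow _ _ _ _
    have hout : ∀ q, q ∉ A → ∑ P, ∑ s, G a a' q P s = if x q = y q then 1 else 0 := by
      intro q h
      simp only [hG, h, dite_false]
      rw [sum_pauli]
      simp only [reduceCtorEq, if_false, zero_mul, Finset.sum_const_zero, zero_add, if_true,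
        one_mul, mul_comm (star _)]
      rw [sum_eigenstate_mul_star]
      exact if_congr eq_comm rfl rfl
    by_cases hxy : agreeOff A x y
    · rw [if_pos hxy]
      by_cases ha : a = fun q : A => x q
      · by_cases ha' : a' = fun q : A => y q
        · rw [if_pos ha, if_pos ha', mul_one]
          refine Finset.prod_eq_one fun q _ => ?_
          by_cases hq : q ∈ A
          · rw [hin q hq, ha, ha']
            simp
          · rw [hout q hq, if_pos (hxy q hq)]
        · rw [if_neg ha', mul_zero]
          obtain ⟨⟨q, hq⟩, hne⟩ := Function.ne_iff.1 ha'
          refine Finset.prod_eq_zero (Finset.mem_univ q) ?_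
          rw [hin q hq, if_neg hne, mul_zero]
      · rw [if_neg ha, zero_mul]
        obtain ⟨⟨q, hq⟩, hne⟩ := Function.ne_iff.1 ha
        refine Finset.prod_eq_zero (Finset.mem_univ q) ?_
        rw [hin q hq, if_neg hne, zero_mul]
    · rw [if_neg hxy]
      obtain ⟨q, hq, hne⟩ : ∃ q, q ∉ A ∧ x q ≠ y q := by
        by_contra hcon
        push Not at hcon
        exact hxy hcon
      refine Finset.prod_eq_zero (Finset.mem_univ q) ?_
      rw [hout q hq, if_neg hne]
  simp only [hterm]
  rw [sum_rotate]
  simp only [sum_rotate (α := Fin n → Pauli) (β := BitString n) (γ := A → Bool)]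
  simp only [← Finset.sum_mul, hsum]
  by_cases hxy : agreeOff A x y
  · simp only [if_pos hxy, ite_mul, mul_ite, one_mul, mul_one, zero_mul, mul_zero]
    simp only [Finset.sum_ite_eq', Finset.mem_univ, if_true]
    rw [star_conditionalState_mul ψ hxy, classProj, of_apply, if_pos ((agreeOff A).symm hxy),
      classWeight_congr ψ hxy]
  · simp only [if_neg hxy, zero_mul, Finset.sum_const_zero]
    rw [classProj, of_apply, if_neg fun h => hxy ((agreeOff A).symm h)]

lemma sum_basisProb_localOverlap {ρ : Matrix (BitString n) (BitString n) ℂ} (hρ : ρ.PosSemidef)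
    (ψ : BitString n → ℂ) (A : Finset (Fin n)) :
    ∑ b, ∑ o, basisProb A b * fidelity ρ (Round.productState ⟨A, b, o⟩) *
      localOverlap ψ ⟨A, b, o⟩ = (ρ * classProj ψ (agreeOff A)).trace.re := by
  have h1 : ∀ b o, basisProb A b * fidelity ρ (Round.productState ⟨A, b, o⟩) *
      localOverlap ψ ⟨A, b, o⟩ = (∑ x, ∑ y, ρ x y * ((basisProb A b : ℂ) *
      (star (Round.productState ⟨A, b, o⟩ x) * Round.productState ⟨A, b, o⟩ y) *
      (star (reducedState ψ ⟨A, b, o⟩) ⬝ᵥ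
        (localShadow ⟨A, b, o⟩ *ᵥ reducedState ψ ⟨A, b, o⟩)))).re := by
    intro b o
    rw [localOverlap, ← Complex.re_ofReal_mul, Complex.ofReal_mul, ofReal_fidelity hρ,
      star_dotProduct_mulVec_eq_sum ρ]
    congr 1
    simp only [Finset.mul_sum, Finset.sum_mul]
    refine Finset.sum_congr rfl fun x _ => Finset.sum_congr rfl fun y _ => by ring
  simp only [h1]
  simp only [← Complex.re_sum]
  congr 1
  rw [sum_rotate]
  simp only [trace, diag_apply, mul_apply, ← sum_shadow_localOverlap, Finset.mul_sum]
  refine Finset.sum_congr rfl fun x _ => ?_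
  rw [sum_rotate]

lemma integral_localOverlap (k : ℕ) {ρ : Matrix (BitString n) (BitString n) ℂ} (hρ : ρ.PosSemidef)
    (ψ : BitString n → ℂ) :
    ∫ r, localOverlap ψ r ∂roundLaw k ρ = 1 / (n.choose k : ℝ) *
      ∑ A ∈ Finset.powersetCard k Finset.univ, (ρ * classProj ψ (agreeOff A)).trace.re := by
  rw [integral_roundLaw k hρ, sum_round, ← sum_if_card]
  refine Finset.sum_congr rfl fun A _ => ?_
  rw [← sum_basisProb_localOverlap hρ, Finset.mul_sum]
  refine Finset.sum_congr rfl fun b _ => ?_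
  rw [Finset.mul_sum]
  refine Finset.sum_congr rfl fun o _ => ?_
  rw [roundProb_mk]
  ring

end FidelityEstimation

/-! ### Median of means -/

namespace FidelityEstimation

open ProbabilityTheory

/-- If the median of `K` numbers is far from `m`, so are at least half of the numbers. -/
lemma card_far_of_median_far {K : ℕ} (hK : 1 ≤ K) (v : Fin K → ℝ) {m t : ℝ}
    (h : t < |median v - m|) :
    K ≤ 2 * (Finset.univ.filter fun j => t < |v j - m|).card := by
  classical
  set l := ((Finset.univ : Finset (Fin K)).val.map v).sort (· ≤ ·) with hl
  have hcoe : (l : Multiset ℝ) = Finset.univ.val.map v := Multiset.sort_eq _ _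
  have hs : l.Pairwise (· ≤ ·) := Multiset.pairwise_sort _ _
  have hlen : l.length = K := by
    have := congrArg Multiset.card hcoe
    simpa using this
  have hcard : (Finset.univ.filter fun j => t < |v j - m|).card =
      l.countP fun x => decide (t < |x - m|) := by
    have h1 := congrArg (Multiset.countP fun x => t < |x - m|) hcoe
    rw [Multiset.coe_countP, Multiset.countP_map] at h1
    rw [h1]
    rfl
  have hmono : ∀ i j (hi : i < l.length) (hj : j < l.length), i ≤ j → l[i] ≤ l[j] := by
    intro i j hi hj hij
    rcases hij.eq_or_lt with rfl | hlt
    · exact le_rfl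
    · exact List.pairwise_iff_getElem.1 hs i j hi hj hlt
  have h1 : (K - 1) / 2 < l.length := by omega
  have h2 : K / 2 < l.length := by omega
  have hmed : median v = (l[(K - 1) / 2] + l[K / 2]) / 2 := by
    simp only [median]
    rw [← hl, List.getD_eq_getElem _ _ h1, List.getD_eq_getElem _ _ h2]
  have hle := hmono _ _ h1 h2 (by omega)
  rw [hcard]
  -- If the median is too large, so is the upper middle entry and everything after it; if too small,
  -- the lower middle entry and everything before it. Either range has at least K/2 entries, for
  -- both parities of K.
  rcases lt_abs.1 h with h | h
  · have hall : ∀ x ∈ l.drop (K / 2), decide (t < |x - m|) = true := by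
      intro x hx
      obtain ⟨i, hi, rfl⟩ := List.mem_iff_getElem.1 hx
      rw [List.getElem_drop]
      rw [List.length_drop] at hi
      have := hmono (K / 2) (K / 2 + i) h2 (by omega) (by omega)
      exact decide_eq_true (lt_abs.2 (Or.inl (by linarith)))
    have h3 := (List.drop_sublist (K / 2) l).countP_le (p := fun x => decide (t < |x - m|))
    rw [List.countP_eq_length.2 hall, List.length_drop] at h3
    omega
  · have hall : ∀ x ∈ l.take ((K - 1) / 2 + 1), decide (t < |x - m|) = true := by
      intro x hx
      obtain ⟨i, hi, rfl⟩ := List.mem_iff_getElem.1 hx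
      rw [List.getElem_take]
      rw [List.length_take] at hi
      have := hmono i ((K - 1) / 2) (by omega) h1 (by omega)
      exact decide_eq_true (lt_abs.2 (Or.inr (by linarith)))
    have h3 := (List.take_sublist ((K - 1) / 2 + 1) l).countP_le
      (p := fun x => decide (t < |x - m|))
    rw [List.countP_eq_length.2 hall, List.length_take] at h3
    omega

/-- Events which depend on disjoint blocks of independent variables are independent. -/
lemma measure_biInter_blocks {Ω ι κ β : Type*} [MeasurableSpace Ω] [MeasurableSpace β]
    [Finite β] [DiscreteMeasurableSpace β] {μ : Measure Ω} [IsProbabilityMeasure μ]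
    {X : ι → Ω → β} (hX : iIndepFun X μ) (hmeas : ∀ i, Measurable (X i)) (D : κ → Finset ι)
    (hD : Pairwise fun j j' => Disjoint (D j) (D j')) (U : ∀ j, Set (D j → β)) (S : Finset κ) :
    μ.real (⋂ j ∈ S, (fun ω (i : D j) => X i ω) ⁻¹' U j) =
      ∏ j ∈ S, μ.real ((fun ω (i : D j) => X i ω) ⁻¹' U j) := by
  classical
  induction S using Finset.induction_on with
  | empty => simp
  | insert a S ha ih =>
    rw [Finset.prod_insert ha, Finset.set_biInter_insert, ← ih]
    have hdisj : Disjoint (D a) (S.biUnion D) := by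
      rw [Finset.disjoint_biUnion_right]
      exact fun j hj => hD fun h => ha (h ▸ hj)
    have hind := hX.indepFun_finset (D a) (S.biUnion D) hdisj hmeas
    -- The events of the blocks in `S` jointly depend only on the union of these blocks, which is
    -- disjoint from the new one.
    have hpre : (⋂ j ∈ S, (fun ω (i : D j) => X i ω) ⁻¹' U j) =
        (fun ω (i : S.biUnion D) => X i ω) ⁻¹' {w | ∀ j (hj : j ∈ S),
          (fun i : D j => w ⟨i, Finset.mem_biUnion.2 ⟨j, hj, i.2⟩⟩) ∈ U j} := by
      ext ω
      simp
    rw [hpre, measureReal_def, hind.measure_inter_preimage_eq_mul _ _ .of_discrete .of_discrete,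
      ENNReal.toReal_mul]
    rfl

/-- The positions of batch `j` among `T` rounds. -/
def batch (T K : ℕ) (j : Fin K) : Finset (Fin T) :=
  Finset.univ.filter fun t : Fin T => (j : ℕ) * (T / K) ≤ t ∧ (t : ℕ) < ((j : ℕ) + 1) * (T / K)

lemma card_batch (T K : ℕ) (j : Fin K) : (batch T K j).card = T / K := by
  have h : ((j : ℕ) + 1) * (T / K) ≤ T :=
    (Nat.mul_le_mul_right _ j.2).trans (Nat.mul_div_le T K)
  have : (batch T K j).map Fin.valEmbedding =
      Finset.Ico ((j : ℕ) * (T / K)) (((j : ℕ) + 1) * (T / K)) := by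
    ext x
    simp only [batch, Finset.mem_map, Finset.mem_filter, Finset.mem_univ, true_and,
      Fin.valEmbedding_apply, Finset.mem_Ico]
    constructor
    · rintro ⟨t, ht, rfl⟩
      exact ht
    · intro hx
      exact ⟨⟨x, hx.2.trans_le h⟩, hx, rfl⟩
  rw [← Finset.card_map Fin.valEmbedding, this, Nat.card_Ico, Nat.add_mul, one_mul,
    Nat.add_sub_cancel_left]

lemma pairwise_disjoint_batch (T K : ℕ) :
    Pairwise fun j j' => Disjoint (batch T K j) (batch T K j') := by
  intro j j' hne
  rw [Finset.disjoint_left]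
  intro t ht ht'
  simp only [batch, Finset.mem_filter, Finset.mem_univ, true_and] at ht ht'
  exact hne (Fin.ext ((Nat.div_eq_of_lt_le ht.1 ht.2).symm.trans
    (Nat.div_eq_of_lt_le ht'.1 ht'.2)))

section MedianOfMeans

variable {α : Type*} [Finite α] [MeasurableSpace α] [DiscreteMeasurableSpace α] {P : Measure α}
  [IsProbabilityMeasure P] {f : α → ℝ} {R : ℝ}

/-- The mean of `f` over batch `j`. -/
noncomputable def meanOverBatch {T : ℕ} (f : α → ℝ) (K : ℕ) (data : Fin T → α) (j : Fin K) : ℝ :=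
  (1 / ((T / K : ℕ) : ℝ)) * ∑ t ∈ batch T K j, f (data t)

/-- Chebyshev's inequality: with batches of size B, the mean has variance at most R²/B, and R²/(B
t²) ≤ 1/16. -/
lemma meanOverBatch_far (hf : ∀ᵐ a ∂P, |f a| ≤ R) {T K : ℕ} (j : Fin K) (hB : 1 ≤ T / K) {t : ℝ}
    (ht : 0 < t) (hR : 16 * R ^ 2 ≤ (T / K : ℕ) * t ^ 2) :
    (Measure.pi fun _ : Fin T => P).real {data | t < |meanOverBatch f K data j - ∫ a, f a ∂P|} ≤
      1 / 16 := by
  set μ := Measure.pi fun _ : Fin T => P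
  set B : ℝ := ((T / K : ℕ) : ℝ) with hBdef
  have hB0 : 0 < B := by rw [hBdef]; exact_mod_cast hB
  have hLp : MemLp f 2 P := .of_bound (by fun_prop) R (by simpa using hf)
  have hev : ∀ i : Fin T, MemLp (fun d : Fin T → α => f (d i)) 2 μ := fun i =>
    hLp.comp_measurePreserving (measurePreserving_eval (fun _ : Fin T => P) i)
  have hEi : ∀ i : Fin T, ∫ d, f (d i) ∂μ = ∫ a, f a ∂P := fun i =>
    integral_comp_eval (μ := fun _ : Fin T => P) (i := i) (f := f) hLp.aestronglyMeasurable
  have hvar : Var[f; P] ≤ R ^ 2 := by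
    refine (variance_le_expectation_sq hLp.aestronglyMeasurable).trans ?_
    have : ∫ a, (f ^ 2) a ∂P ≤ ∫ _, R ^ 2 ∂P := by
      refine integral_mono_ae (.of_finite) (integrable_const _) ?_
      filter_upwards [hf] with a ha
      exact sq_le_sq' (neg_le_of_abs_le ha) (le_of_abs_le ha)
    simpa using this
  have hvari : ∀ i : Fin T, Var[fun d : Fin T → α => f (d i); μ] = Var[f; P] := by
    intro i
    have hmap : μ.map (fun d : Fin T → α => d i) = P :=
      (measurePreserving_eval (fun _ : Fin T => P) i).map_eq
    have h := variance_map (μ := μ) (X := f) (Y := fun d : Fin T → α => d i)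
      (by rw [hmap]; exact hLp.aestronglyMeasurable.aemeasurable)
      (measurable_pi_apply i).aemeasurable
    rw [hmap] at h
    exact h.symm
  have hind : iIndepFun (fun i (d : Fin T → α) => f (d i)) μ :=
    iIndepFun_pi fun i => hLp.aestronglyMeasurable.aemeasurable
  have hmean : ∫ d, meanOverBatch f K d j ∂μ = ∫ a, f a ∂P := by
    simp only [meanOverBatch]
    rw [integral_const_mul, integral_finsetSum _ fun i _ => (hev i).integrable (by norm_num)]
    simp only [hEi, Finset.sum_const, card_batch, nsmul_eq_mul]
    rw [← mul_assoc, one_div_mul_cancel hB0.ne', one_mul]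
  have hvarB : Var[fun d => meanOverBatch f K d j; μ] ≤ R ^ 2 / B := by
    have h1 : Var[∑ i ∈ batch T K j, fun d : Fin T → α => f (d i); μ] ≤ B * R ^ 2 := by
      rw [IndepFun.variance_sum (fun i _ => hev i) fun i _ i' _ h => hind.indepFun h]
      simp only [hvari, Finset.sum_const, card_batch, nsmul_eq_mul]
      exact mul_le_mul_of_nonneg_left hvar hB0.le
    have h2 : (fun d => meanOverBatch f K d j) =
        fun d => (1 / B) * (∑ i ∈ batch T K j, fun d : Fin T → α => f (d i)) d := by
      funext d
      simp [meanOverBatch, hBdef]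
    rw [h2, variance_const_mul]
    calc (1 / B) ^ 2 * _ ≤ (1 / B) ^ 2 * (B * R ^ 2) :=
          mul_le_mul_of_nonneg_left h1 (by positivity)
      _ = R ^ 2 / B := by field_simp
  have hLpB : MemLp (fun d => meanOverBatch f K d j) 2 μ := by
    simp only [meanOverBatch]
    exact (memLp_finsetSum _ fun i _ => hev i).const_mul _
  have hcheb := meas_ge_le_variance_div_sq hLpB ht
  rw [hmean] at hcheb
  have hsub : μ {data | t < |meanOverBatch f K data j - ∫ a, f a ∂P|} ≤ ENNReal.ofReal (1 / 16) := by
    refine (measure_mono fun d hd => ?_).trans (hcheb.trans (ENNReal.ofReal_le_ofReal ?_))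
    · rw [Set.mem_ofPred_eq] at hd ⊢
      exact hd.le
    · rw [div_le_iff₀ (by positivity)]
      refine hvarB.trans ?_
      rw [div_le_iff₀ hB0]
      linarith
  rw [measureReal_def]
  exact ENNReal.toReal_le_of_le_ofReal (by norm_num) hsub

/-- The median of means of independent copies of a bounded variable concentrates. -/
lemma medianOfMeans_far (hf : ∀ᵐ a ∂P, |f a| ≤ R) {T K : ℕ} (hK : 1 ≤ K) (hB : 1 ≤ T / K) {t : ℝ}
    (ht : 0 < t) (hR : 16 * R ^ 2 ≤ (T / K : ℕ) * t ^ 2) :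
    (Measure.pi fun _ : Fin T => P).real
      {data | t < |median (meanOverBatch f K data) - ∫ a, f a ∂P|} ≤ (1 / 2) ^ K := by
  classical
  set μ := Measure.pi fun _ : Fin T => P
  set m := ∫ a, f a ∂P
  set E : Fin K → Set (Fin T → α) := fun j => {data | t < |meanOverBatch f K data j - m|} with hE
  have hprod : ∀ S : Finset (Fin K), μ.real (⋂ j ∈ S, E j) = ∏ j ∈ S, μ.real (E j) := by
    intro S
    have hind : iIndepFun (fun i (d : Fin T → α) => d i) μ :=
      iIndepFun_pi (X := fun _ a => a) fun i => aemeasurable_id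
    have h := measure_biInter_blocks hind (fun i => measurable_pi_apply i) (batch T K)
      (pairwise_disjoint_batch T K)
      (fun j => {w | t < |(1 / ((T / K : ℕ) : ℝ)) * ∑ i, f (w i) - m|}) S
    have hEj : ∀ j, E j = (fun (ω : Fin T → α) (i : batch T K j) => ω i) ⁻¹'
        {w | t < |(1 / ((T / K : ℕ) : ℝ)) * ∑ i, f (w i) - m|} := by
      intro j
      ext d
      simp only [hE, meanOverBatch, Set.mem_ofPred_eq, Set.mem_preimage]
      rw [Finset.sum_coe_sort (batch T K j) fun i => f (d i)]
    simp only [hEj]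
    exact h
  -- A bad median makes a set `S` of at least K/2 batches bad. Each such `S` has probability at most
  -- (1/16)^|S| ≤ (1/4)^K, and there are at most 2^K of them.
  have hsub : {data | t < |median (meanOverBatch f K data) - m|} ⊆
      ⋃ S ∈ (Finset.univ : Finset (Finset (Fin K))).filter fun S => K ≤ 2 * S.card,
        ⋂ j ∈ S, E j := by
    intro d hd
    simp only [Set.mem_iUnion, Finset.mem_filter, Finset.mem_univ, true_and]
    refine ⟨_, card_far_of_median_far hK _ hd, ?_⟩
    simp [hE]
  calc _ ≤ μ.real (⋃ S ∈ (Finset.univ : Finset (Finset (Fin K))).filter fun S => K ≤ 2 * S.card,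
        ⋂ j ∈ S, E j) := measureReal_mono hsub (measure_ne_top μ _)
    _ ≤ ∑ S ∈ (Finset.univ : Finset (Finset (Fin K))).filter fun S => K ≤ 2 * S.card,
        μ.real (⋂ j ∈ S, E j) := measureReal_biUnion_finset_le _ _
    _ ≤ ∑ S ∈ (Finset.univ : Finset (Finset (Fin K))).filter fun S => K ≤ 2 * S.card,
        (1 / 4 : ℝ) ^ K := by
        refine Finset.sum_le_sum fun S hS => ?_
        rw [hprod]
        calc ∏ j ∈ S, μ.real (E j) ≤ ∏ _j ∈ S, (1 / 16 : ℝ) :=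
              Finset.prod_le_prod (fun _ _ => measureReal_nonneg) fun j _ =>
                meanOverBatch_far hf j hB ht hR
          _ = (1 / 4 : ℝ) ^ (2 * S.card) := by
              rw [Finset.prod_const, pow_mul]
              norm_num
          _ ≤ (1 / 4 : ℝ) ^ K := pow_le_pow_of_le_one (by norm_num) (by norm_num)
              (Finset.mem_filter.1 hS).2
    _ ≤ ∑ _S : Finset (Fin K), (1 / 4 : ℝ) ^ K :=
        Finset.sum_le_sum_of_subset_of_nonneg (Finset.filter_subset _ _) fun _ _ _ => by positivity
    _ = (1 / 2) ^ K := by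
        rw [Finset.sum_const, Finset.card_univ, Fintype.card_finset, Fintype.card_fin,
          nsmul_eq_mul]
        push_cast
        rw [← mul_pow]
        norm_num

end MedianOfMeans

end FidelityEstimation

/-! ### Bias bounds, constants and the theorem -/

namespace FidelityEstimation

variable {n : ℕ}

lemma one_sub_one_div_mixingTime (k : ℕ) (ψ : BitString n → ℂ) :
    1 - 1 / mixingTime k ψ = secondEigenvalue k ψ := by
  rw [mixingTime, one_div_one_div, sub_sub_cancel]

lemma bias_bounds {k : ℕ} (hk : 1 ≤ k) (hkn : k ≤ n) {ρ : Matrix (BitString n) (BitString n) ℂ}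
    (hρ : IsState ρ) {ψ : BitString n → ℂ} (hψ : IsPureState ψ) (hl : secondEigenvalue k ψ < 1) :
    0 ≤ bias k ρ ψ ∧ bias k ρ ψ ≤ secondEigenvalue k ψ * (1 - fidelity ρ ψ) := by
  rw [bias, integral_localOverlap k hρ.1]
  have h1 := fidelity_le_average_classProj hkn hρ.1 hψ
  have h2 := average_classProj_agreeOff_le hk hkn hρ.1 ψ
  have h3 := re_trace_mul_flipAverage_le hk hkn hρ hψ hl
  constructor <;> linarith

lemma ae_abs_localOverlap_le (k : ℕ) (ρ : Matrix (BitString n) (BitString n) ℂ)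
    (ψ : BitString n → ℂ) : ∀ᵐ r ∂roundLaw k ρ, |localOverlap ψ r| ≤ 2 ^ k := by
  filter_upwards [ae_card_roundLaw k ρ] with r hr
  exact hr ▸ abs_localOverlap_le ψ r

/-- With nonempty batches of size B, T ≤ K(B + 1) ≤ 2KB ≤ 8LB, so the constant 128 leaves the 16
required by the median of means. -/
lemma fidelityEstimate_far {k : ℕ} (hkn : k ≤ n) {ρ : Matrix (BitString n) (BitString n) ℂ}
    (hρ : IsState ρ) (ψ : BitString n → ℂ) {T K : ℕ} (hK : 1 ≤ K) {t L : ℝ} (ht : 0 < t)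
    (hL : 0 < L) (hKL : (K : ℝ) ≤ 4 * L) (hT : 128 * (2 ^ k) ^ 2 * L ≤ T * t ^ 2) :
    (dataLaw k ρ T).real {data | t < |fidelityEstimate ψ K data -
      ∫ r, localOverlap ψ r ∂roundLaw k ρ|} ≤ (1 / 2) ^ K := by
  have := isProbabilityMeasure_roundLaw hkn hρ
  have hω := ae_abs_localOverlap_le k ρ ψ
  have hR : (0 : ℝ) < (2 ^ k) ^ 2 := by positivity
  by_cases hB : 1 ≤ T / K
  · refine medianOfMeans_far hω hK hB ht ?_
    have hB1 : (1 : ℝ) ≤ (T / K : ℕ) := by exact_mod_cast hB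
    have hTB : (T : ℝ) ≤ K * ((T / K : ℕ) + 1) := by
      exact_mod_cast (Nat.lt_mul_div_succ T hK).le
    have h1 : (T : ℝ) ≤ 8 * L * (T / K : ℕ) := by
      have hK0 : (0 : ℝ) ≤ K := by positivity
      calc (T : ℝ) ≤ K * (2 * (T / K : ℕ)) := hTB.trans (by gcongr; linarith)
        _ ≤ 4 * L * (2 * (T / K : ℕ)) := by gcongr
        _ = _ := by ring
    have h2 := hT.trans (mul_le_mul_of_nonneg_right h1 (sq_nonneg t))
    refine le_of_mul_le_mul_left (a := 8 * L) ?_ (by positivity)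
    linarith
  -- With fewer rounds than batches all batch means are 0 by convention. Then T ≤ K ≤ 4L forces t ≥
  -- 2^k ≥ |𝔼[ω]|, so the estimate 0 is not far from the mean.
  · have hB0 : T / K = 0 := Nat.lt_one_iff.1 (not_le.1 hB)
    have hTK : (T : ℝ) ≤ K := by
      exact_mod_cast ((Nat.div_eq_zero_iff.1 hB0).resolve_left (by omega)).le
    have hlt : (2 : ℝ) ^ k ≤ t := by
      refine le_of_sq_le_sq ?_ ht.le
      have h1 := hT.trans (mul_le_mul_of_nonneg_right (hTK.trans hKL) (sq_nonneg t))
      have h2 : L * (32 * (2 ^ k) ^ 2) ≤ L * t ^ 2 := by linarith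
      have := le_of_mul_le_mul_left h2 hL
      linarith
    have hm : |∫ r, localOverlap ψ r ∂roundLaw k ρ| ≤ 2 ^ k := by
      simpa using norm_integral_le_of_norm_le_const
        (f := localOverlap ψ) (μ := roundLaw k ρ) (C := 2 ^ k) hω
    have hempty : {data : Fin T → Round n | t < |fidelityEstimate ψ K data -
        ∫ r, localOverlap ψ r ∂roundLaw k ρ|} = ∅ := by
      refine Set.eq_empty_of_forall_notMem fun data hd => ?_
      have h := card_far_of_median_far hK _ hd
      obtain ⟨j, hj⟩ := Finset.card_pos.1 (Nat.pos_of_mul_pos_left (hK.trans h))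
      have hj := (Finset.mem_filter.1 hj).2
      simp only [batchMean, hB0, Nat.cast_zero, div_zero, zero_mul, zero_sub, abs_neg] at hj
      linarith
    rw [hempty, measureReal_empty]
    positivity

lemma half_pow_ceil_le {x : ℝ} (hx : 1 ≤ x) :
    (1 / 2 : ℝ) ^ ⌈2 * Real.log x⌉₊ ≤ 1 / x := by
  have hx0 : 0 < x := by linarith
  have hlog := Real.log_nonneg hx
  rw [← Real.exp_log (by positivity : (0 : ℝ) < (1 / 2) ^ ⌈2 * Real.log x⌉₊),
    ← Real.exp_log (by positivity : (0 : ℝ) < 1 / x), Real.exp_le_exp, Real.log_pow, one_div,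
    one_div, Real.log_inv, Real.log_inv]
  have h1 := Nat.le_ceil (2 * Real.log x)
  have h2 := Real.log_two_gt_d9
  -- What matters is 2 ln 2 > 1.
  nlinarith

end FidelityEstimation

theorem theorem1 :
    ∃ C : ℝ, 0 < C ∧
      ∀ (n k M : ℕ), 1 ≤ k → k ≤ n → 1 ≤ M →
      ∀ (ρ : Matrix (BitString n) (BitString n) ℂ) (ψ : Fin M → BitString n → ℂ),
        IsState ρ → (∀ i, IsPureState (ψ i)) →
        -- all the mixing times are finite
        (∀ i, secondEigenvalue k (ψ i) < 1) →
        -- the bias is nonnegative and controlled by the mixing time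
        (∀ i, 0 ≤ bias k ρ (ψ i) ∧
          bias k ρ (ψ i) ≤ (1 - 1 / mixingTime k (ψ i)) * (1 - fidelity ρ (ψ i))) ∧
        ∀ (ε δ c_b : ℝ), 0 < ε → 0 < δ →
          (∀ i, 0 < c_b / mixingTime k (ψ i) ∧ c_b / mixingTime k (ψ i) < 1) →
          -- the bias, or its upper bound `1 - 1 / τ_i`, is not too close to `ε`
          (∀ i, 1 - 1 / mixingTime k (ψ i) ≤ (1 - c_b / mixingTime k (ψ i)) * ε ∨
            bias k ρ (ψ i) ≤ (1 - c_b / mixingTime k (ψ i)) * ε) →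
          ∀ T : ℕ,
            C * (2 ^ (2 * k) * ((⨆ i, mixingTime k (ψ i) ^ 2) / (c_b * ε) ^ 2) *
              Real.log (2 * M / δ)) ≤ T →
            -- one data set serves all the targets, with `K = ⌈2 ln (2 M / δ)⌉` batches
            ENNReal.ofReal (1 - δ) ≤ dataLaw k ρ T
              {data | ∀ i, |fidelityEstimate (ψ i) ⌈2 * Real.log (2 * M / δ)⌉₊ data
                - fidelity ρ (ψ i)| ≤ ε} := by
  refine ⟨128, by norm_num, fun n k M hk hkn hM ρ ψ hρ hψ hl => ⟨fun i => ?_, ?_⟩⟩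
  · rw [one_sub_one_div_mixingTime]
    exact bias_bounds hk hkn hρ (hψ i) (hl i)
  intro ε δ c_b hε hδ hc hbias T hT
  rcases le_or_gt 1 δ with hδ1 | hδ1
  · rw [ENNReal.ofReal_of_nonpos (by linarith)]
    exact zero_le
  have hP := isProbabilityMeasure_roundLaw hkn hρ
  have hD : IsProbabilityMeasure (dataLaw k ρ T) := by unfold dataLaw; infer_instance
  have hM1 : (1 : ℝ) ≤ M := by exact_mod_cast hM
  set x : ℝ := 2 * M / δ with hx
  have hx2 : 2 ≤ x := by
    rw [hx, le_div_iff₀ hδ]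
    nlinarith
  set L := Real.log x with hLdef
  -- This absorbs the rounding of `K`: 2L + 1 < 4L.
  have hL : 1 / 2 < L := by
    have h1 := Real.log_le_log (by norm_num) hx2
    have h2 := Real.log_two_gt_d9
    linarith
  set K := ⌈2 * L⌉₊ with hKdef
  have hK : 1 ≤ K := Nat.one_le_ceil_iff.2 (by linarith)
  have hKL : (K : ℝ) ≤ 4 * L := by
    have := Nat.ceil_lt_add_one (by linarith : 0 ≤ 2 * L)
    linarith
  have hτ : ∀ i, 0 < mixingTime k (ψ i) := fun i => one_div_pos.2 (sub_pos.2 (hl i))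
  have hcb : 0 < c_b := by
    have h := mul_pos (hc ⟨0, hM⟩).1 (hτ ⟨0, hM⟩)
    rwa [div_mul_cancel₀ _ (hτ ⟨0, hM⟩).ne'] at h
  -- The part of ε left for the statistical error when the bias takes up to (1 - c_b/τ_i) ε.
  set t : Fin M → ℝ := fun i => c_b / mixingTime k (ψ i) * ε with ht
  have ht0 : ∀ i, 0 < t i := fun i => mul_pos (hc i).1 hε
  set far : Fin M → Set (Fin T → Round n) := fun i => {data | t i <
    |fidelityEstimate (ψ i) K data - ∫ r, localOverlap (ψ i) r ∂roundLaw k ρ|} with hfar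
  have hfar_le : ∀ i, (dataLaw k ρ T).real (far i) ≤ δ / (2 * M) := by
    intro i
    refine (fidelityEstimate_far hkn hρ (ψ i) hK (ht0 i) (by linarith) hKL ?_).trans
      ((half_pow_ceil_le (by linarith)).trans_eq (by rw [hx, one_div_div]))
    have hsup : mixingTime k (ψ i) ^ 2 ≤ ⨆ i, mixingTime k (ψ i) ^ 2 :=
      le_ciSup (f := fun i => mixingTime k (ψ i) ^ 2) (Set.finite_range _).bddAbove i
    have h1 : 128 * (2 ^ (2 * k) * (mixingTime k (ψ i) ^ 2 / (c_b * ε) ^ 2) * L) ≤ T := by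
      refine le_trans ?_ hT
      gcongr
    have h2 := mul_le_mul_of_nonneg_right h1 (sq_nonneg (t i))
    refine le_trans (le_of_eq ?_) h2
    have := (hτ i).ne'
    simp only [ht]
    field_simp
    ring
  have hunion : (dataLaw k ρ T).real (⋃ i, far i) ≤ δ := by
    calc (dataLaw k ρ T).real (⋃ i, far i) ≤ ∑ i, (dataLaw k ρ T).real (far i) :=
          measureReal_iUnion_fintype_le _
      _ ≤ ∑ _i : Fin M, δ / (2 * M) := Finset.sum_le_sum fun i _ => hfar_le i
      _ = δ / 2 := by
          rw [Finset.sum_const, Finset.card_univ, Fintype.card_fin, nsmul_eq_mul]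
          field_simp
      _ ≤ δ := by linarith
  have hcompl : 1 - δ ≤ (dataLaw k ρ T).real (⋃ i, far i)ᶜ := by
    rw [probReal_compl_eq_one_sub .of_discrete]
    linarith
  refine (ENNReal.ofReal_le_ofReal hcompl).trans ?_
  rw [ofReal_measureReal]
  refine measure_mono fun data hdata i => ?_
  have hnot : ¬ t i < |fidelityEstimate (ψ i) K data - ∫ r, localOverlap (ψ i) r ∂roundLaw k ρ| :=
    fun h => hdata (Set.mem_iUnion.2 ⟨i, h⟩)
  obtain ⟨hb0, hb1⟩ := bias_bounds hk hkn hρ (hψ i) (hl i)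
  have hlam := (flipAverage_spectral_bound hk hkn (hψ i) (hl i)).1
  -- The first alternative implies the second, since λ₁(1 - F) ≤ λ₁.
  have hbi : bias k ρ (ψ i) ≤ (1 - c_b / mixingTime k (ψ i)) * ε := by
    rcases hbias i with h | h
    · rw [one_sub_one_div_mixingTime] at h
      have := mul_nonneg hlam (fidelity_nonneg hρ.1 (ψ i))
      linarith
    · exact h
  rw [bias] at hb0 hbi
  have hnot := abs_le.1 (not_lt.1 hnot)
  simp only [ht] at hnot
  rw [abs_le]
  -- From above, bias and deviation add up to at most ε; from below, the nonnegative bias only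
  -- helps.
  constructor <;> linarith [hnot.1, hnot.2]
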